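/- Work over $\mathbb{C}$ and with $\mathbb{C}$-points. Let $\mathrm{SL}_2((t))$ be the loop group, let $I=\{\begin{pmatrix}a&b\\tc&d\end{pmatrix}\in \mathrm{SL}_2((t)) : a,b,c,d\in\mathbb{C}[[t]]\}$ be the standard Iwahori subgroup, and consider its subgroups $$I_3=\Big\{\begin{pmatrix}a&t^2b\\t^2c&d\end{pmatrix}\Big\},\qquad I_4=\Big\{\begin{pmatrix}\alpha(1+t^2a)&t^2b\\t^2c&\alpha^{-1}(1+t^2d)\end{pmatrix}\Big\},\qquad a,b,c,d\in\mathbb{C}[[t]],\ \alpha\in\mathbb{C}^\times,\ \det=1,$$ obtained from $I$ by removing the root subgroups of $\alpha_1,\alpha_0,\delta+\alpha_1$, respectively of $\alpha_1,\alpha_0,\delta,\delta+\alpha_1$. Let $I_4^{\mathrm{rot}}=I_4\rtimes\mathbb{G}_m^{\mathrm{rot}}$, where $\gamma\in\mathbb{G}_m^{\mathrm{rot}}=\mathbb{C}^\times$ acts by loop rotation $t\mapsto\gamma t$. All these groups act on the affine flag variety $\mathrm{SL}_2((t))/I$. For $n\in\mathbb{Z}$ and $p\in\mathbb{C}((t))$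 put $$[n,p]=\begin{pmatrix}t^n&p\\0&t^{-n}\end{pmatrix}I,\qquad [n,p]'=\begin{pmatrix}p&t^n\\-t^{-n}&0\end{pmatrix}I .$$ For a set $S\subseteq\mathbb{C}((t))$ write $[n,S]=\{[n,p]:p\in S\}$, and similarly for $[n,S]'$; a sum $\mathbb{C}t^l+\dots+\mathbb{C}t^u$ with $u<l$ is $\{0\}$. Define the following subsets of $\mathrm{SL}_2((t))/I$. * $E_0=\{[0,0]\}$. * $E_n^{\mathrm{open}}=[n,\mathbb{C}^\times t^{-n}+\mathbb{C}t^{-n+1}+\dots+\mathbb{C}t^{n-1}]$ for $n>0$, and $E_n^{\mathrm{open}}=[-n-1,\mathbb{C}^\times t^{n}+\mathbb{C}t^{n+1}+\dots+\mathbb{C}t^{-n-1}]'$ for $n<0$. * $E_n^{\mathrm{hyp}}=\{[n,0]\}\cup\bigcup_{m=n}^{-n-2}[m,\mathbb{C}^\times t^n+\mathbb{C}t^{n+1}+\dots+\mathbb{C}t^m]'$ for $n<0$. * $O_n^{\mathrm{open}}=[n,\mathbb{C}^\times t^{-n}+\mathbb{C}t^{-n+1}+\dots+\mathbb{C}t^{n}]'$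 for $n\ge0$, and $O_n^{\mathrm{open}}=[-n-1,\mathbb{C}^\times t^{n}+\mathbb{C}t^{n+1}+\dots+\mathbb{C}t^{-n-2}]$ for $n<0$. * $O_n^{\mathrm{hyp}}=\{[n,0]'\}\cup\bigcup_{m=n+1}^{-n-2}[m,\mathbb{C}^\times t^n+\mathbb{C}t^{n+1}+\dots+\mathbb{C}t^{m-1}]$ for $n\le0$. * For $n>0$: $E_n^{\mathrm{hyp\,open}}=[n,\mathbb{C}^\times t^{-n+1}+\mathbb{C}t^{-n+2}+\dots+\mathbb{C}t^{n-1}]$, $E_n^{\mathrm{hyp\,hyp}}=[n,\mathbb{C}t^{-n+2}+\dots+\mathbb{C}t^{n-1}]$, $O_n^{\mathrm{hyp\,open}}=[n,\mathbb{C}^\times t^{-n+1}+\mathbb{C}t^{-n+2}+\dots+\mathbb{C}t^{n}]'$, $O_n^{\mathrm{hyp\,hyp}}=[n,\mathbb{C}t^{-n+2}+\dots+\mathbb{C}t^{n}]'$. **Proposition.** The $I_3$-orbits in $\mathrm{SL}_2((t))/I$ are exactly the sets $E_0$; $E_n^{\mathrm{open}}$ $(n\ne0)$; $E_n^{\mathrm{hyp}}$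 $(n<0)$; $O_n^{\mathrm{open}}$ $(n\in\mathbb{Z})$; $O_n^{\mathrm{hyp}}$ $(n\le0)$; $E_n^{\mathrm{hyp\,open}}$, $E_n^{\mathrm{hyp\,hyp}}$, $O_n^{\mathrm{hyp\,open}}$, $O_n^{\mathrm{hyp\,hyp}}$ $(n>0)$. Each of them is an $I_4^{\mathrm{rot}}$-orbit or decomposes into two $I_4^{\mathrm{rot}}$-orbits, as follows. 0. $E_0=\{[0,0]\}$, $O_0^{\mathrm{hyp}}=\{[0,0]'\}$, $O_{-1}^{\mathrm{hyp}}=\{[-1,0]'\}$ and $E_1^{\mathrm{hyp\,hyp}}=\{[1,0]\}$ are point orbits of $I_4$ and of $I_4^{\mathrm{rot}}$. 1. For $n<0$, $E_n^{\mathrm{open}}$ and $E_n^{\mathrm{hyp}}$ are $I_4$-orbits. 2. $O_n^{\mathrm{open}}$ for $n\le0$ and $O_n^{\mathrm{hyp}}$ for $n\le-2$ are $I_4$-orbits. 3. $E_n^{\mathrm{hyp\,open}}$ for $n>0$ and $E_n^{\mathrm{hyp\,hyp}}$ for $n\ge2$ are $I_4$-orbits. 4. For $n>0$, $O_n^{\mathrm{hyp\,open}}$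 and $O_n^{\mathrm{hyp\,hyp}}$ are $I_4$-orbits. 5. For $n>0$, $E_n^{\mathrm{open}}$ is the disjoint union of the $I_4^{\mathrm{rot}}$-orbit $$E_n^{\mathrm{open\,open}}=[n,\mathbb{C}^\times t^{-n}+\mathbb{C}^\times t^{-n+1}+\mathbb{C}t^{-n+2}+\dots+\mathbb{C}t^{n-1}]\cong\mathbb{G}_m^2\times\mathbb{A}^{2n-2}$$ and the $I_4$-orbit $$E_n^{\mathrm{open\,hyp}}=[n,\mathbb{C}^\times t^{-n}+\mathbb{C}t^{-n+2}+\dots+\mathbb{C}t^{n-1}]\cong\mathbb{G}_m\times\mathbb{A}^{2n-2}.$$ 6. For $n>0$, $O_n^{\mathrm{open}}$ is the disjoint union of the $I_4^{\mathrm{rot}}$-orbit $$O_n^{\mathrm{open\,open}}=[n,\mathbb{C}^\times t^{-n}+\mathbb{C}^\times t^{-n+1}+\mathbb{C}t^{-n+2}+\dots+\mathbb{C}t^{n}]'\cong\mathbb{G}_m^2\times\mathbb{A}^{2n-1}$$ and the $I_4$-orbit $$O_n^{\mathrm{open\,hyp}}=[n,\mathbb{C}^\times t^{-n}+\mathbb{C}t^{-n+2}+\dots+\mathbb{C}t^{n}]'\cong\mathbb{G}_m\times\mathbb{A}^{2n-1}.$$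 Here $\cong$ denotes isomorphism of varieties, and every $I_4$-orbit named in 1.–6. is also an $I_4^{\mathrm{rot}}$-orbit. -/

import Mathlib

open scoped LaurentSeries PowerSeries

namespace AffineFlag

noncomputable section

/-! ### The loop group `SL₂((t))` and the subgroups `I`, `I₃`, `I₄` -/

/-- The loop group `SL₂((t))` over `ℂ` (its `ℂ`-points). -/
abbrev LoopSL2 : Type := Matrix.SpecialLinearGroup (Fin 2) ℂ⸨X⸩

/-- The inclusion `ℂ[[t]] → ℂ((t))`. -/
abbrev incl : ℂ⟦X⟧ →+* ℂ⸨X⸩ := HahnSeries.ofPowerSeries ℤ ℂ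

/-- The Laurent monomial `t ^ n`. -/
abbrev tpow (n : ℤ) : ℂ⸨X⸩ := HahnSeries.single n 1

theorem mat_congr {R : Type*} {a b c d a' b' c' d' : R} (h1 : a = a') (h2 : b = b') (h3 : c = c')
    (h4 : d = d') : !![a, b; c, d] = !![a', b'; c', d'] := by
  rw [h1, h2, h3, h4]

/-- The subgroup of `SL₂((t))` of the matrices of determinant one that lie in a given set `S` of
matrices over `ℂ[[t]]`, where `S` contains `1` and is closed under products and adjugates. -/
def integralSubgroup (S : Set (Matrix (Fin 2) (Fin 2) ℂ⟦X⟧)) (h_one : 1 ∈ S)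
    (h_mul : ∀ M ∈ S, ∀ N ∈ S, M * N ∈ S) (h_adj : ∀ M ∈ S, M.adjugate ∈ S) :
    Subgroup LoopSL2 where
  carrier := {g | ∃ M ∈ S, (g : Matrix (Fin 2) (Fin 2) ℂ⸨X⸩) = M.map incl}
  one_mem' := ⟨1, h_one, by simp⟩
  mul_mem' := by
    rintro g h ⟨M, hM, hg⟩ ⟨N, hN, hh⟩
    exact ⟨M * N, h_mul M hM N hN, by
      rw [Matrix.SpecialLinearGroup.coe_mul, hg, hh, Matrix.map_mul]⟩
  inv_mem' := by
    rintro g ⟨M, hM, hg⟩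
    refine ⟨M.adjugate, h_adj M hM, ?_⟩
    rw [Matrix.SpecialLinearGroup.coe_inv, hg]
    exact (RingHom.map_adjugate incl M).symm

/-- The standard Iwahori subgroup `I`: matrices `(a, b; t c, d)` with `a, b, c, d ∈ ℂ[[t]]`
(and determinant one). -/
def Iwahori : Subgroup LoopSL2 :=
  integralSubgroup {M | ∃ a b c d : ℂ⟦X⟧, M = !![a, b; PowerSeries.X * c, d]}
    ⟨1, 0, 0, 1, by simp [Matrix.one_fin_two]⟩
    (by
      rintro _ ⟨a, b, c, d, rfl⟩ _ ⟨a', b', c', d', rfl⟩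
      refine ⟨a * a' + b * (PowerSeries.X * c'), a * b' + b * d', c * a' + d * c',
        PowerSeries.X * c * b' + d * d', ?_⟩
      rw [Matrix.mul_fin_two]
      exact mat_congr (by ring) (by ring) (by ring) (by ring))
    (by
      rintro _ ⟨a, b, c, d, rfl⟩
      refine ⟨d, -b, -c, a, ?_⟩
      rw [Matrix.adjugate_fin_two_of]
      exact mat_congr (by ring) (by ring) (by ring) (by ring))

/-- The subgroup `I₃` of `I` obtained by removing the root subgroups of `α₁`, `α₀`, `δ + α₁`:
matrices `(a, t² b; t² c, d)` with `a, b, c, d ∈ ℂ[[t]]` (and determinant one). -/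
def I3 : Subgroup LoopSL2 :=
  integralSubgroup
    {M | ∃ a b c d : ℂ⟦X⟧, M = !![a, PowerSeries.X ^ 2 * b; PowerSeries.X ^ 2 * c, d]}
    ⟨1, 0, 0, 1, by simp [Matrix.one_fin_two]⟩
    (by
      rintro _ ⟨a, b, c, d, rfl⟩ _ ⟨a', b', c', d', rfl⟩
      refine ⟨a * a' + PowerSeries.X ^ 4 * (b * c'), a * b' + b * d', c * a' + d * c',
        PowerSeries.X ^ 4 * (c * b') + d * d', ?_⟩
      rw [Matrix.mul_fin_two]
      exact mat_congr (by ring) (by ring) (by ring) (by ring))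
    (by
      rintro _ ⟨a, b, c, d, rfl⟩
      refine ⟨d, -b, -c, a, ?_⟩
      rw [Matrix.adjugate_fin_two_of]
      exact mat_congr (by ring) (by ring) (by ring) (by ring))

/-- The subgroup `I₄` of `I` obtained by removing the root subgroups of `α₁`, `α₀`, `δ`, `δ + α₁`:
matrices `(α (1 + t² a), t² b; t² c, α⁻¹ (1 + t² d))` with `α ∈ ℂˣ` and `a, b, c, d ∈ ℂ[[t]]`
(and determinant one, i.e. `a + d + t² (a d - b c) = 0`). -/
def I4 : Subgroup LoopSL2 :=
  integralSubgroup
    {M | ∃ (α : ℂˣ) (a b c d : ℂ⟦X⟧),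
      M = !![PowerSeries.C (α : ℂ) * (1 + PowerSeries.X ^ 2 * a), PowerSeries.X ^ 2 * b;
             PowerSeries.X ^ 2 * c,
             PowerSeries.C ((α⁻¹ : ℂˣ) : ℂ) * (1 + PowerSeries.X ^ 2 * d)]}
    ⟨1, 0, 0, 0, 0, by simp [Matrix.one_fin_two]⟩
    (by
      rintro _ ⟨α, a, b, c, d, rfl⟩ _ ⟨β, a', b', c', d', rfl⟩
      have key : ∀ γ : ℂˣ, (PowerSeries.C (γ : ℂ) : ℂ⟦X⟧) *
          PowerSeries.C ((γ⁻¹ : ℂˣ) : ℂ) = 1 := by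
        intro γ
        rw [← map_mul, Units.mul_inv, map_one]
      have e1 := key α
      have e2 := key β
      refine ⟨α * β,
        a + a' + PowerSeries.X ^ 2 * (a * a') + PowerSeries.C ((α⁻¹ : ℂˣ) : ℂ) *
          PowerSeries.C ((β⁻¹ : ℂˣ) : ℂ) * (PowerSeries.X ^ 2 * (b * c')),
        PowerSeries.C (α : ℂ) * (1 + PowerSeries.X ^ 2 * a) * b' +
          b * (PowerSeries.C ((β⁻¹ : ℂˣ) : ℂ) * (1 + PowerSeries.X ^ 2 * d')),
        c * (PowerSeries.C (β : ℂ) * (1 + PowerSeries.X ^ 2 * a')) +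
          PowerSeries.C ((α⁻¹ : ℂˣ) : ℂ) * (1 + PowerSeries.X ^ 2 * d) * c',
        d + d' + PowerSeries.X ^ 2 * (d * d') + PowerSeries.C (α : ℂ) *
          PowerSeries.C (β : ℂ) * (PowerSeries.X ^ 2 * (c * b')), ?_⟩
      rw [Matrix.mul_fin_two]
      simp only [mul_inv, Units.val_mul, map_mul]
      generalize (PowerSeries.C (α : ℂ) : ℂ⟦X⟧) = A at *
      generalize (PowerSeries.C (β : ℂ) : ℂ⟦X⟧) = B at *
      generalize (PowerSeries.C ((α⁻¹ : ℂˣ) : ℂ) : ℂ⟦X⟧) = A' at *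
      generalize (PowerSeries.C ((β⁻¹ : ℂˣ) : ℂ) : ℂ⟦X⟧) = B' at *
      have e3 : A * B * (A' * B') = 1 := by
        rw [mul_mul_mul_comm, e1, e2, one_mul]
      exact mat_congr (by linear_combination (-(PowerSeries.X ^ 4 * (b * c'))) * e3) (by ring)
        (by ring) (by linear_combination (-(PowerSeries.X ^ 4 * (c * b'))) * e3))
    (by
      rintro _ ⟨α, a, b, c, d, rfl⟩
      refine ⟨α⁻¹, d, -b, -c, a, ?_⟩
      rw [Matrix.adjugate_fin_two_of, inv_inv, mul_neg, mul_neg])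

/-- The affine flag variety `SL₂((t)) / I` (its `ℂ`-points). -/
abbrev Flag : Type := LoopSL2 ⧸ Iwahori

/-! ### Loop rotation and the group `I₄^rot = I₄ ⋊ G_m^rot` -/

/-- The substitution `p(t) ↦ p(γ t)` on Laurent series. -/
def rescaleT (γ : ℂˣ) (p : ℂ⸨X⸩) : ℂ⸨X⸩ where
  coeff k := ((γ ^ k : ℂˣ) : ℂ) * p.coeff k
  isPWO_support' := p.isPWO_support.mono fun k hk => by
    simp only [Function.mem_support] at hk
    exact right_ne_zero_of_mul hk

theorem rescaleT_coeff (γ : ℂˣ) (p : ℂ⸨X⸩) (k : ℤ) :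
    (rescaleT γ p).coeff k = ((γ ^ k : ℂˣ) : ℂ) * p.coeff k := rfl

theorem rescaleT_support (γ : ℂˣ) (p : ℂ⸨X⸩) : (rescaleT γ p).support ⊆ p.support := fun k hk => by
  rw [HahnSeries.mem_support, rescaleT_coeff] at hk
  exact right_ne_zero_of_mul hk

theorem rescaleT_one_left (p : ℂ⸨X⸩) : rescaleT 1 p = p := by
  ext k
  simp [rescaleT_coeff]

theorem rescaleT_mul_left (γ γ' : ℂˣ) (p : ℂ⸨X⸩) : rescaleT (γ * γ') p = rescaleT γ (rescaleT γ' p) := by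
  ext k
  simp [rescaleT_coeff, mul_zpow, mul_assoc]

theorem rescaleT_mul (γ : ℂˣ) (p q : ℂ⸨X⸩) : rescaleT γ (p * q) = rescaleT γ p * rescaleT γ q := by
  ext k
  rw [rescaleT_coeff, HahnSeries.coeff_mul, Finset.mul_sum,
    HahnSeries.coeff_mul_left' p.isPWO_support (rescaleT_support γ p)]
  rw [Finset.sum_subset (s₁ := Finset.antidiagonal p.isPWO_support
    (rescaleT γ q).isPWO_support k) (s₂ := Finset.antidiagonal p.isPWO_support q.isPWO_support k)]
  · refine Finset.sum_congr rfl fun ij hij => ?_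
    rw [Finset.mem_antidiagonal] at hij
    rw [rescaleT_coeff, rescaleT_coeff, ← hij.2.2, zpow_add, Units.val_mul]
    ring
  · intro ij hij
    rw [Finset.mem_antidiagonal] at hij ⊢
    exact ⟨hij.1, rescaleT_support γ q hij.2.1, hij.2.2⟩
  · intro ij hij hij'
    rw [Finset.mem_antidiagonal] at hij hij'
    have : (rescaleT γ q).coeff ij.2 = 0 := by
      by_contra h
      exact hij' ⟨hij.1, h, hij.2.2⟩
    rw [this, mul_zero]

/-- The substitution `p(t) ↦ p(γ t)` as a ring homomorphism. -/
def rescaleTHom (γ : ℂˣ) : ℂ⸨X⸩ →+* ℂ⸨X⸩ where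
  toFun := rescaleT γ
  map_one' := by
    ext k
    rw [rescaleT_coeff, HahnSeries.coeff_one]
    by_cases h : k = 0 <;> simp [h]
  map_mul' := rescaleT_mul γ
  map_zero' := by
    ext k
    simp [rescaleT_coeff]
  map_add' p q := by
    ext k
    simp [rescaleT_coeff, mul_add]

/-- The action of `G_m^rot` on `SL₂((t))` by loop rotation `t ↦ γ t`. -/
def rot : ℂˣ →* MulAut LoopSL2 where
  toFun γ :=
    { toFun := Matrix.SpecialLinearGroup.map (rescaleTHom γ)
      invFun := Matrix.SpecialLinearGroup.map (rescaleTHom γ⁻¹)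
      left_inv := fun g => by
        refine Matrix.SpecialLinearGroup.ext _ _ fun i j => ?_
        change rescaleT γ⁻¹ (rescaleT γ (g i j)) = g i j
        rw [← rescaleT_mul_left, inv_mul_cancel, rescaleT_one_left]
      right_inv := fun g => by
        refine Matrix.SpecialLinearGroup.ext _ _ fun i j => ?_
        change rescaleT γ (rescaleT γ⁻¹ (g i j)) = g i j
        rw [← rescaleT_mul_left, mul_inv_cancel, rescaleT_one_left]
      map_mul' := map_mul _ }
  map_one' := by
    refine MulEquiv.ext fun g => Matrix.SpecialLinearGroup.ext _ _ fun i j => ?_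
    exact rescaleT_one_left (g i j)
  map_mul' γ γ' := by
    refine MulEquiv.ext fun g => Matrix.SpecialLinearGroup.ext _ _ fun i j => ?_
    exact rescaleT_mul_left γ γ' (g i j)

theorem rot_apply (γ : ℂˣ) (g : LoopSL2) (i j : Fin 2) : (rot γ g) i j = rescaleT γ (g i j) := rfl

theorem rescaleT_incl (γ : ℂˣ) (f : ℂ⟦X⟧) :
    rescaleT γ (incl f) = incl (PowerSeries.rescale (γ : ℂ) f) := by
  ext k
  rw [rescaleT_coeff, PowerSeries.coeff_coe, PowerSeries.coeff_coe]
  split_ifs with h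
  · simp
  · rw [PowerSeries.coeff_rescale]
    obtain ⟨m, rfl⟩ := Int.eq_ofNat_of_zero_le (not_lt.mp h)
    simp

theorem rot_of_map (γ : ℂˣ) (g : LoopSL2) (M : Matrix (Fin 2) (Fin 2) ℂ⟦X⟧)
    (h : (g : Matrix (Fin 2) (Fin 2) ℂ⸨X⸩) = M.map incl) :
    ((rot γ g : LoopSL2) : Matrix (Fin 2) (Fin 2) ℂ⸨X⸩) =
      (M.map (PowerSeries.rescale (γ : ℂ))).map incl := by
  ext i j : 1
  have h' : g i j = incl (M i j) := congrFun (congrFun h i) j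
  change (rot γ g) i j = _
  rw [rot_apply, h', rescaleT_incl]
  rfl

theorem rescale_C (γ x : ℂ) :
    PowerSeries.rescale γ (PowerSeries.C x : ℂ⟦X⟧) = PowerSeries.C x := by
  ext k
  rw [PowerSeries.coeff_rescale, PowerSeries.coeff_C]
  by_cases h : k = 0 <;> simp [h]

theorem rot_mem_Iwahori (γ : ℂˣ) {g : LoopSL2} (hg : g ∈ Iwahori) : rot γ g ∈ Iwahori := by
  obtain ⟨_, ⟨a, b, c, d, rfl⟩, hg⟩ := hg
  refine ⟨_, ⟨PowerSeries.rescale (γ : ℂ) a, PowerSeries.rescale (γ : ℂ) b,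
    PowerSeries.C (γ : ℂ) * PowerSeries.rescale (γ : ℂ) c, PowerSeries.rescale (γ : ℂ) d, rfl⟩, ?_⟩
  rw [rot_of_map γ g _ hg]
  congr 1
  ext i j : 1
  fin_cases i <;> fin_cases j <;> simp
  ring

theorem rot_mem_I4 (γ : ℂˣ) {g : LoopSL2} (hg : g ∈ I4) : rot γ g ∈ I4 := by
  obtain ⟨_, ⟨α, a, b, c, d, rfl⟩, hg⟩ := hg
  refine ⟨_, ⟨α, PowerSeries.C (γ : ℂ) ^ 2 * PowerSeries.rescale (γ : ℂ) a,
    PowerSeries.C (γ : ℂ) ^ 2 * PowerSeries.rescale (γ : ℂ) b,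
    PowerSeries.C (γ : ℂ) ^ 2 * PowerSeries.rescale (γ : ℂ) c,
    PowerSeries.C (γ : ℂ) ^ 2 * PowerSeries.rescale (γ : ℂ) d, rfl⟩, ?_⟩
  rw [rot_of_map γ g _ hg]
  congr 1
  ext i j : 1
  fin_cases i <;> fin_cases j <;> simp [rescale_C] <;> ring

/-- The action of `G_m^rot` on `SL₂((t)) / I` induced by loop rotation. -/
def rotFlag (γ : ℂˣ) : Flag → Flag :=
  Quotient.map' (rot γ) fun g h hgh => by
    rw [QuotientGroup.leftRel_apply] at hgh ⊢
    rw [← map_inv, ← map_mul]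
    exact rot_mem_Iwahori γ hgh

theorem rotFlag_mk (γ : ℂˣ) (g : LoopSL2) : rotFlag γ (g : Flag) = ((rot γ g : LoopSL2) : Flag) :=
  rfl

/-- The semidirect product `SL₂((t)) ⋊ G_m^rot` acts on `SL₂((t)) / I`, with `SL₂((t))` acting by
left translations and `G_m^rot` by loop rotation. -/
instance : MulAction (LoopSL2 ⋊[rot] ℂˣ) Flag where
  smul x q := x.left • rotFlag x.right q
  one_smul q := by
    induction q using QuotientGroup.induction_on with
    | H g =>
      change (1 : LoopSL2) • rotFlag 1 (g : Flag) = g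
      rw [one_smul, rotFlag_mk, map_one]
      rfl
  mul_smul x y q := by
    induction q using QuotientGroup.induction_on with
    | H g =>
      change ((x.left * rot x.right y.left * (rot (x.right * y.right) g) : LoopSL2) : Flag) =
        ((x.left * rot x.right (y.left * rot y.right g) : LoopSL2) : Flag)
      rw [map_mul, map_mul, MulAut.mul_apply, mul_assoc]

/-- The group `I₄^rot = I₄ ⋊ G_m^rot`, as a subgroup of `SL₂((t)) ⋊ G_m^rot`. -/
def I4rot : Subgroup (LoopSL2 ⋊[rot] ℂˣ) where
  carrier := {x | x.left ∈ I4}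
  one_mem' := I4.one_mem
  mul_mem' := fun {x _} hx hy => I4.mul_mem hx (rot_mem_I4 x.right hy)
  inv_mem' := fun {x} hx => rot_mem_I4 x.right⁻¹ (I4.inv_mem hx)

/-- `X` is an orbit of the group `H`. -/
def IsOrbit (H : Type*) [Group H] {α : Type*} [MulAction H α] (X : Set α) : Prop :=
  ∃ x : α, X = MulAction.orbit H x

/-! ### Coordinates on the affine flag variety and the subsets under consideration -/

/-- The matrix `(t^n, p; 0, t^(-n))`. -/
def upperRep (n : ℤ) (p : ℂ⸨X⸩) : LoopSL2 :=
  ⟨!![tpow n, p; 0, tpow (-n)], by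
    rw [Matrix.det_fin_two_of]
    simp [HahnSeries.single_mul_single]⟩

/-- The matrix `(p, t^n; -t^(-n), 0)`. -/
def primeRep (n : ℤ) (p : ℂ⸨X⸩) : LoopSL2 :=
  ⟨!![p, tpow n; -tpow (-n), 0], by
    have h : tpow n * tpow (-n) = 1 := by
      rw [HahnSeries.single_mul_single, add_neg_cancel, mul_one]
      rfl
    rw [Matrix.det_fin_two_of]
    linear_combination h⟩

/-- The point `[n, p] = (t^n, p; 0, t^(-n)) I` of `SL₂((t)) / I`. -/
def pt (n : ℤ) (p : ℂ⸨X⸩) : Flag := (upperRep n p : Flag)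

/-- The point `[n, p]' = (p, t^n; -t^(-n), 0) I` of `SL₂((t)) / I`. -/
def ptPrime (n : ℤ) (p : ℂ⸨X⸩) : Flag := (primeRep n p : Flag)

/-- `ℂ t^l + ℂ t^(l+1) + ⋯ + ℂ t^u`, which is `0` if `u < l`. -/
def laurentSpan (l u : ℤ) : Set ℂ⸨X⸩ := {p | ∀ k : ℤ, p.coeff k ≠ 0 → l ≤ k ∧ k ≤ u}

/-- `E_n^open`, `n ≠ 0`. -/
def Eopen (n : ℤ) : Set Flag :=
  if 0 < n then pt n '' {p | p ∈ laurentSpan (-n) (n - 1) ∧ p.coeff (-n) ≠ 0}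
  else ptPrime (-n - 1) '' {p | p ∈ laurentSpan n (-n - 1) ∧ p.coeff n ≠ 0}

/-- `E_n^hyp`, `n < 0`. -/
def Ehyp (n : ℤ) : Set Flag :=
  (⋃ m ∈ Set.Icc n (-n - 2), ptPrime m '' {p | p ∈ laurentSpan n m ∧ p.coeff n ≠ 0}) ∪ {pt n 0}

/-- `O_n^open`, `n ∈ ℤ`. -/
def Oopen (n : ℤ) : Set Flag :=
  if 0 ≤ n then ptPrime n '' {p | p ∈ laurentSpan (-n) n ∧ p.coeff (-n) ≠ 0}
  else pt (-n - 1) '' {p | p ∈ laurentSpan n (-n - 2) ∧ p.coeff n ≠ 0}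

/-- `O_n^hyp`, `n ≤ 0`; in particular `O_0^hyp = {[0, 0]'}` and `O_{-1}^hyp = {[-1, 0]'}`. -/
def Ohyp (n : ℤ) : Set Flag :=
  (⋃ m ∈ Set.Icc (n + 1) (-n - 2), pt m '' {p | p ∈ laurentSpan n (m - 1) ∧ p.coeff n ≠ 0}) ∪
    {ptPrime n 0}

/-- `E_n^{hyp open}`, `n > 0`. -/
def EhypOpen (n : ℤ) : Set Flag :=
  pt n '' {p | p ∈ laurentSpan (-n + 1) (n - 1) ∧ p.coeff (-n + 1) ≠ 0}

/-- `E_n^{hyp hyp}`, `n > 0`. -/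
def EhypHyp (n : ℤ) : Set Flag := pt n '' laurentSpan (-n + 2) (n - 1)

/-- `O_n^{hyp open}`, `n > 0`. -/
def OhypOpen (n : ℤ) : Set Flag :=
  ptPrime n '' {p | p ∈ laurentSpan (-n + 1) n ∧ p.coeff (-n + 1) ≠ 0}

/-- `O_n^{hyp hyp}`, `n > 0`. -/
def OhypHyp (n : ℤ) : Set Flag := ptPrime n '' laurentSpan (-n + 2) n

/-- `E_n^{open open}`, `n > 0`. -/
def EopenOpen (n : ℤ) : Set Flag :=
  pt n '' {p | p ∈ laurentSpan (-n) (n - 1) ∧ p.coeff (-n) ≠ 0 ∧ p.coeff (-n + 1) ≠ 0}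

/-- `E_n^{open hyp}`, `n > 0`. -/
def EopenHyp (n : ℤ) : Set Flag :=
  pt n '' {p | p ∈ laurentSpan (-n) (n - 1) ∧ p.coeff (-n) ≠ 0 ∧ p.coeff (-n + 1) = 0}

/-- `O_n^{open open}`, `n > 0`. -/
def OopenOpen (n : ℤ) : Set Flag :=
  ptPrime n '' {p | p ∈ laurentSpan (-n) n ∧ p.coeff (-n) ≠ 0 ∧ p.coeff (-n + 1) ≠ 0}

/-- `O_n^{open hyp}`, `n > 0`. -/
def OopenHyp (n : ℤ) : Set Flag :=
  ptPrime n '' {p | p ∈ laurentSpan (-n) n ∧ p.coeff (-n) ≠ 0 ∧ p.coeff (-n + 1) = 0}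

/-! ### Varieties as spaces with functions

A set `M` of points with coordinates `c : M → ι → ℂ` (the `ℂ`-points of a locally closed subvariety
of an affine space, possibly with countably many coordinates) carries the Zariski topology and the
sheaf of regular functions, which are locally quotients of polynomials in the coordinates. -/

/-- `U` is open in the Zariski topology on `M` given by the coordinates `c`. -/
def ZariskiOpen {M ι : Type*} (c : M → ι → ℂ) (U : Set M) : Prop :=
  ∀ x ∈ U, ∃ Q : MvPolynomial ι ℂ, MvPolynomial.eval (c x) Q ≠ 0 ∧
    ∀ y, MvPolynomial.eval (c y) Q ≠ 0 → y ∈ U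

/-- `f` is a regular function on the Zariski open subset `U` of `M`. -/
def RegularOn {M ι : Type*} (c : M → ι → ℂ) (U : Set M) (f : M → ℂ) : Prop :=
  ∀ x ∈ U, ∃ P Q : MvPolynomial ι ℂ, MvPolynomial.eval (c x) Q ≠ 0 ∧
    ∀ y ∈ U, MvPolynomial.eval (c y) Q ≠ 0 →
      f y = MvPolynomial.eval (c y) P / MvPolynomial.eval (c y) Q

/-- The coordinates on `G_m^a × 𝔸^b`. -/
def torusAffineCoord (a b : ℕ) (x : (Fin a → ℂˣ) × (Fin b → ℂ)) : Fin a ⊕ Fin b → ℂ :=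
  Sum.elim (fun i => (x.1 i : ℂ)) x.2

/-- The coordinates on the preimage of `E ⊆ SL₂((t)) / I` in `SL₂((t))`: all coefficients of the
four matrix entries. -/
def loopCoord (E : Set Flag) (g : {g : LoopSL2 // (g : Flag) ∈ E}) : Fin 2 × Fin 2 × ℤ → ℂ :=
  fun k => (g.1 k.1 k.2.1).coeff k.2.2

/-- The projection from the preimage of `E` in `SL₂((t))` to `E`. -/
def proj (E : Set Flag) (g : {g : LoopSL2 // (g : Flag) ∈ E}) : E := ⟨(g.1 : Flag), g.2⟩

/-- A subset of `E ⊆ SL₂((t)) / I` is Zariski open if its preimage in `SL₂((t))` is, that is, `E`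
has the quotient topology.  (For `E` contained in a finite union of Schubert cells, where the pole
orders of the matrix entries are bounded on the preimage, this is the topology induced from the
ind-variety `SL₂((t)) / I`.) -/
def FlagOpen (E : Set Flag) (V : Set E) : Prop := ZariskiOpen (loopCoord E) (proj E ⁻¹' V)

/-- A function on an open subset `V` of `E ⊆ SL₂((t)) / I` is regular if its pullback to the
preimage in `SL₂((t))` is. -/
def FlagRegularOn (E : Set Flag) (V : Set E) (f : E → ℂ) : Prop :=
  RegularOn (loopCoord E) (proj E ⁻¹' V) (f ∘ proj E)

/-- The subvariety `E` of `SL₂((t)) / I` is isomorphic to `G_m^a × 𝔸^b`: there is a homeomorphism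
for the Zariski topologies which identifies the sheaves of regular functions. -/
def IsoTorusAffine (E : Set Flag) (a b : ℕ) : Prop :=
  ∃ φ : ((Fin a → ℂˣ) × (Fin b → ℂ)) ≃ E,
    (∀ V : Set E, FlagOpen E V ↔ ZariskiOpen (torusAffineCoord a b) (φ ⁻¹' V)) ∧
    ∀ (V : Set E) (f : E → ℂ), FlagOpen E V →
      (FlagRegularOn E V f ↔ RegularOn (torusAffineCoord a b) (φ ⁻¹' V) (f ∘ φ))

end

end AffineFlag

open AffineFlag

namespace AffineFlag

noncomputable section

/-! ### Laurent series of bounded order -/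

/-! A coset g I is the same thing as a ball s + t^N ℂ[[t]] in ℂ((t)), or an edge of the tree of SL₂
pointed towards ∞. The point [n, p] is the ball of exponent 2n around t^n p, and [n, p]' is the ball
of exponent 2n + 1 around -t^n p. Every coset arises (`exists_eq_ball`), and two balls of the same
exponent N agree iff their centers agree modulo t^N (`ball_eq_ball_iff`). As long as its pole avoids
the ball, a matrix acts by its Möbius transformation (`smul_ball`). Loop rotation acts on the
center.

Let N ≥ 0 and let the center s be integral. A matrix in I₃ has b, c ∈ t² ℂ[[t]] and a d ≡ 1 modulo
t⁴, so modulo t² it multiplies s by a², with a a unit. Translations by t² ℂ[[t]] lie in I₄, so only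
s₀ + s₁ t matters. Under I₃ the order of s, cut off at 2, is then the only invariant, because every
unit has a square root modulo t². Under I₄ the factor a² is a constant modulo t² (`I4_mobius`).
Order 1 and order ≥ 2 still give single orbits, but for a unit s the ratio s₁ / s₀ becomes an
invariant. Rotation by γ multiplies this ratio by γ, leaving two I₄^rot-orbits: ratio nonzero and
ratio zero. If N = 1, the ball does not see s₁ and nothing splits.

The remaining balls, with center of negative order or with center 0 and N < 0, are reached by s ↦
-s⁻¹. This is the action of `weyl`, which normalizes I₃ and I₄ and is fixed by rotation. Inversion
turns orders 1 and ≥ 2 into -1 and ≤ -2, together with a ball around 0; this produces the unions in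
E_n^hyp and O_n^hyp. The listed sets are orbits and cover everything (`exists_isListed_mem`), so
they are all the orbits.

For the isomorphisms of varieties, the coefficients of s in degrees below N are coordinates. The
explicit matrix `ballRep` is a section, and s modulo t^N is recovered from any representative as the
ratio of the entries of one column, whose coefficients are fractions in the matrix coefficients
(`columnSlope`). -/

theorem tpow_mul_tpow (k l : ℤ) : tpow k * tpow l = tpow (k + l) := by
  rw [HahnSeries.single_mul_single, mul_one]

theorem tpow_zero : tpow 0 = 1 := rfl

theorem tpow_mul_tpow_neg (k : ℤ) : tpow k * tpow (-k) = 1 := by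
  rw [tpow_mul_tpow, add_neg_cancel, tpow_zero]

theorem coeff_tpow_mul (k m : ℤ) (x : ℂ⸨X⸩) : (tpow k * x).coeff m = x.coeff (m - k) := by
  have h := HahnSeries.coeff_single_mul_add (r := (1 : ℂ)) (x := x) (a := m - k) (b := k)
  rwa [sub_add_cancel, one_mul] at h

theorem coeff_tpow (k m : ℤ) : (tpow k).coeff m = if m = k then 1 else 0 := by
  split_ifs with h
  · rw [h, HahnSeries.coeff_single_same]
  · exact HahnSeries.coeff_single_of_ne h

theorem coeff_C_mul (r : ℂ) (x : ℂ⸨X⸩) (m : ℤ) :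
    (HahnSeries.C r * x).coeff m = r * x.coeff m := by
  rw [HahnSeries.C_mul_eq_smul, HahnSeries.coeff_smul, smul_eq_mul]

theorem coeff_incl_natCast (f : ℂ⟦X⟧) (k : ℕ) : (incl f).coeff (k : ℤ) = PowerSeries.coeff k f := by
  exact LaurentSeries.coeff_coe_powerSeries f k

/-- The Laurent series of order at least `k`. -/
def laurentGE (k : ℤ) : AddSubgroup ℂ⸨X⸩ where
  carrier := {x | ∀ j < k, x.coeff j = 0}
  zero_mem' := fun _ _ => rfl
  add_mem' := fun {x y} hx hy j hj => by
    rw [HahnSeries.coeff_add, hx j hj, hy j hj, add_zero]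
  neg_mem' := fun {x} hx j hj => by
    rw [HahnSeries.coeff_neg, hx j hj, neg_zero]

theorem laurentGE_mono {k l : ℤ} (h : l ≤ k) {x : ℂ⸨X⸩} (hx : x ∈ laurentGE k) :
    x ∈ laurentGE l := fun j hj => hx j (hj.trans_le h)

theorem tpow_mul_mem {k l : ℤ} {x : ℂ⸨X⸩} (hx : x ∈ laurentGE l) :
    tpow k * x ∈ laurentGE (k + l) := fun j hj => by
  rw [coeff_tpow_mul]
  exact hx _ (by lia)

theorem incl_mem (f : ℂ⟦X⟧) : incl f ∈ laurentGE 0 := fun j hj => by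
  rw [PowerSeries.coeff_coe, if_pos hj]

theorem exists_incl {x : ℂ⸨X⸩} (hx : x ∈ laurentGE 0) : ∃ f, x = incl f := by
  refine ⟨PowerSeries.mk fun k => x.coeff k, ?_⟩
  ext j
  rw [PowerSeries.coeff_coe]
  split_ifs with h
  · exact hx j h
  · obtain ⟨m, rfl⟩ := Int.eq_ofNat_of_zero_le (not_lt.mp h)
    simp

theorem exists_tpow_mul_incl {k : ℤ} {x : ℂ⸨X⸩} (hx : x ∈ laurentGE k) :
    ∃ f, x = tpow k * incl f := by
  obtain ⟨f, hf⟩ := exists_incl (x := tpow (-k) * x) (by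
    simpa using tpow_mul_mem (k := -k) hx)
  exact ⟨f, by rw [← hf, ← mul_assoc, tpow_mul_tpow_neg, one_mul]⟩

theorem tpow_mul_incl_mem (k : ℤ) (f : ℂ⟦X⟧) : tpow k * incl f ∈ laurentGE k := by
  simpa using tpow_mul_mem (k := k) (incl_mem f)

theorem tpow_mem (k : ℤ) : tpow k ∈ laurentGE k := by
  simpa using tpow_mul_incl_mem k 1

theorem mul_mem_laurentGE {k l m : ℤ} {x y : ℂ⸨X⸩} (hx : x ∈ laurentGE k) (hy : y ∈ laurentGE l)
    (hm : m ≤ k + l) : x * y ∈ laurentGE m := by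
  obtain ⟨f, rfl⟩ := exists_tpow_mul_incl hx
  obtain ⟨g, rfl⟩ := exists_tpow_mul_incl hy
  refine laurentGE_mono hm ?_
  rw [mul_mul_mul_comm, tpow_mul_tpow, ← map_mul]
  exact tpow_mul_incl_mem _ _

theorem C_mem (r : ℂ) : HahnSeries.C r ∈ laurentGE 0 := fun j hj => by
  rw [HahnSeries.C_apply, HahnSeries.coeff_single_of_ne hj.ne]

theorem one_mem_laurentGE : (1 : ℂ⸨X⸩) ∈ laurentGE 0 := tpow_mem 0

theorem coeff_mul_of_mem {k l : ℤ} {x y : ℂ⸨X⸩} (hx : x ∈ laurentGE k) (hy : y ∈ laurentGE l) :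
    (x * y).coeff (k + l) = x.coeff k * y.coeff l := by
  obtain ⟨f, rfl⟩ := exists_tpow_mul_incl hx
  obtain ⟨g, rfl⟩ := exists_tpow_mul_incl hy
  rw [mul_mul_mul_comm, tpow_mul_tpow, ← map_mul, coeff_tpow_mul, coeff_tpow_mul, coeff_tpow_mul,
    sub_self, sub_self, sub_self]
  have h (f : ℂ⟦X⟧) : (incl f).coeff 0 = PowerSeries.coeff 0 f := coeff_incl_natCast f 0
  rw [h, h, h]
  simp

theorem mem_laurentGE_succ {k : ℤ} {x : ℂ⸨X⸩} (hx : x ∈ laurentGE k) (h : x.coeff k = 0) :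
    x ∈ laurentGE (k + 1) := fun j hj => by
  rcases (Int.lt_add_one_iff.mp hj).lt_or_eq with h' | rfl
  · exact hx j h'
  · exact h

/-- `x` has order exactly `k`. -/
def HasOrder (k : ℤ) (x : ℂ⸨X⸩) : Prop := x ∈ laurentGE k ∧ x.coeff k ≠ 0

namespace HasOrder

variable {k l : ℤ} {x y : ℂ⸨X⸩}

theorem ne_zero (hx : HasOrder k x) : x ≠ 0 := by
  rintro rfl
  exact hx.2 rfl

theorem mul (hx : HasOrder k x) (hy : HasOrder l y) : HasOrder (k + l) (x * y) :=
  ⟨mul_mem_laurentGE hx.1 hy.1 le_rfl, by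
    rw [coeff_mul_of_mem hx.1 hy.1]
    exact mul_ne_zero hx.2 hy.2⟩

theorem neg (hx : HasOrder k x) : HasOrder k (-x) :=
  ⟨neg_mem hx.1, by rw [HahnSeries.coeff_neg]; exact neg_ne_zero.mpr hx.2⟩

theorem add_of_mem (hx : HasOrder k x) (hy : y ∈ laurentGE (k + 1)) : HasOrder k (x + y) :=
  ⟨add_mem hx.1 (laurentGE_mono (by lia) hy), by
    rw [HahnSeries.coeff_add, hy k (by lia), add_zero]
    exact hx.2⟩

theorem of_sub_mem (hx : HasOrder k x) (h : y - x ∈ laurentGE (k + 1)) : HasOrder k y := by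
  simpa using hx.add_of_mem h

theorem of_mem_not_mem (hx : x ∈ laurentGE k) (h : x ∉ laurentGE (k + 1)) : HasOrder k x :=
  ⟨hx, fun h0 => h (mem_laurentGE_succ hx h0)⟩

theorem le_of_mem (hx : HasOrder k x) (h : x ∈ laurentGE l) : l ≤ k := by
  by_contra! hlt
  exact hx.2 (h k hlt)

theorem unique (hx : HasOrder k x) (hx' : HasOrder l x) : k = l :=
  le_antisymm (hx'.le_of_mem hx.1) (hx.le_of_mem hx'.1)

theorem inv (hx : HasOrder k x) : HasOrder (-k) x⁻¹ := by
  have h0 : x⁻¹ ≠ 0 := inv_ne_zero hx.ne_zero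
  have h : HasOrder x⁻¹.order x⁻¹ :=
    ⟨fun j hj => HahnSeries.coeff_eq_zero_of_lt_order hj, HahnSeries.coeff_order_eq_zero.not.mpr h0⟩
  have h1 := hx.mul h
  rw [mul_inv_cancel₀ hx.ne_zero] at h1
  have h2 : HasOrder 0 (1 : ℂ⸨X⸩) := ⟨one_mem_laurentGE, by simp⟩
  have h3 := h1.unique h2
  rwa [show -k = x⁻¹.order by lia]

end HasOrder

theorem hasOrder_order {x : ℂ⸨X⸩} (hx : x ≠ 0) : HasOrder x.order x :=
  ⟨fun _ hj => HahnSeries.coeff_eq_zero_of_lt_order hj, HahnSeries.coeff_order_eq_zero.not.mpr hx⟩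

theorem exists_hasOrder {x : ℂ⸨X⸩} (hx : x ≠ 0) : ∃ k, HasOrder k x := ⟨_, hasOrder_order hx⟩

theorem hasOrder_tpow (k : ℤ) : HasOrder k (tpow k) := ⟨tpow_mem k, by simp⟩

theorem hasOrder_C {r : ℂ} (hr : r ≠ 0) : HasOrder 0 (HahnSeries.C r) := ⟨C_mem r, by simpa⟩

theorem hasOrder_one : HasOrder 0 (1 : ℂ⸨X⸩) := hasOrder_tpow 0

/-- Every Laurent series either has order at least `N` or has some exact order `k < N`. -/
theorem hasOrder_or_mem (N : ℤ) (x : ℂ⸨X⸩) : x ∈ laurentGE N ∨ ∃ k < N, HasOrder k x := by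
  by_cases h : x ∈ laurentGE N
  · exact Or.inl h
  · have hx : x ≠ 0 := by
      rintro rfl
      exact h (zero_mem _)
    obtain ⟨k, hk⟩ := exists_hasOrder hx
    refine Or.inr ⟨k, ?_, hk⟩
    by_contra! hle
    exact h (laurentGE_mono hle hk.1)

/-! ### Membership in the subgroups of the loop group -/

theorem det_loop (g : LoopSL2) : g 0 0 * g 1 1 - g 0 1 * g 1 0 = 1 := by
  rw [← Matrix.det_fin_two]
  exact g.2

theorem exists_incl_X_pow {k : ℕ} {x : ℂ⸨X⸩} (hx : x ∈ laurentGE k) :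
    ∃ f, x = incl (PowerSeries.X ^ k * f) := by
  obtain ⟨f, hf⟩ := exists_tpow_mul_incl hx
  refine ⟨f, ?_⟩
  rw [hf, map_mul, HahnSeries.ofPowerSeries_X_pow]

theorem incl_X_pow_mem (k : ℕ) (f : ℂ⟦X⟧) : incl (PowerSeries.X ^ k * f) ∈ laurentGE k := by
  rw [map_mul, HahnSeries.ofPowerSeries_X_pow]
  exact tpow_mul_incl_mem _ _

theorem loop_eq_map {g : LoopSL2} {a b c d : ℂ⟦X⟧} :
    (g : Matrix (Fin 2) (Fin 2) ℂ⸨X⸩) = (!![a, b; c, d]).map incl ↔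
      g 0 0 = incl a ∧ g 0 1 = incl b ∧ g 1 0 = incl c ∧ g 1 1 = incl d := by
  constructor
  · intro h
    refine ⟨?_, ?_, ?_, ?_⟩ <;> simp [h]
  · rintro ⟨h1, h2, h3, h4⟩
    ext i j : 1
    fin_cases i <;> fin_cases j <;> simpa

theorem mem_Iwahori {g : LoopSL2} : g ∈ Iwahori ↔
    g 0 0 ∈ laurentGE 0 ∧ g 0 1 ∈ laurentGE 0 ∧ g 1 0 ∈ laurentGE 1 ∧ g 1 1 ∈ laurentGE 0 := by
  constructor
  · rintro ⟨_, ⟨a, b, c, d, rfl⟩, hg⟩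
    obtain ⟨h1, h2, h3, h4⟩ := loop_eq_map.mp hg
    rw [h1, h2, h3, h4]
    exact ⟨incl_mem _, incl_mem _, by simpa using incl_X_pow_mem 1 c, incl_mem _⟩
  · rintro ⟨h1, h2, h3, h4⟩
    obtain ⟨a, ha⟩ := exists_incl h1
    obtain ⟨b, hb⟩ := exists_incl h2
    obtain ⟨c, hc⟩ := exists_incl_X_pow (k := 1) (by simpa using h3)
    obtain ⟨d, hd⟩ := exists_incl h4
    exact ⟨_, ⟨a, b, c, d, rfl⟩, loop_eq_map.mpr ⟨ha, hb, by simpa using hc, hd⟩⟩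

theorem mem_I3 {g : LoopSL2} : g ∈ I3 ↔
    g 0 0 ∈ laurentGE 0 ∧ g 0 1 ∈ laurentGE 2 ∧ g 1 0 ∈ laurentGE 2 ∧ g 1 1 ∈ laurentGE 0 := by
  constructor
  · rintro ⟨_, ⟨a, b, c, d, rfl⟩, hg⟩
    obtain ⟨h1, h2, h3, h4⟩ := loop_eq_map.mp hg
    rw [h1, h2, h3, h4]
    exact ⟨incl_mem _, incl_X_pow_mem 2 b, incl_X_pow_mem 2 c, incl_mem _⟩
  · rintro ⟨h1, h2, h3, h4⟩
    obtain ⟨a, ha⟩ := exists_incl h1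
    obtain ⟨b, hb⟩ := exists_incl_X_pow (k := 2) h2
    obtain ⟨c, hc⟩ := exists_incl_X_pow (k := 2) h3
    obtain ⟨d, hd⟩ := exists_incl h4
    exact ⟨_, ⟨a, b, c, d, rfl⟩, loop_eq_map.mpr ⟨ha, hb, hc, hd⟩⟩

/-- Turns the multiplicative shape of the diagonal entries of I₄ into a congruence modulo t², so
that membership in I₄ only involves bounds on orders. -/
theorem sub_C_mem_iff {x : ℂ⸨X⸩} (α : ℂˣ) : x - HahnSeries.C (α : ℂ) ∈ laurentGE 2 ↔
    ∃ a, x = incl (PowerSeries.C (α : ℂ) * (1 + PowerSeries.X ^ 2 * a)) := by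
  constructor
  · intro h
    obtain ⟨f, hf⟩ := exists_incl_X_pow (k := 2) h
    refine ⟨PowerSeries.C ((α⁻¹ : ℂˣ) : ℂ) * f, ?_⟩
    have e : (PowerSeries.C (α : ℂ) : ℂ⟦X⟧) * PowerSeries.C ((α⁻¹ : ℂˣ) : ℂ) = 1 := by
      rw [← map_mul, Units.mul_inv, map_one]
    have : PowerSeries.C (α : ℂ) * (1 + PowerSeries.X ^ 2 * (PowerSeries.C ((α⁻¹ : ℂˣ) : ℂ) * f)) =
        PowerSeries.C (α : ℂ) + PowerSeries.X ^ 2 * f := by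
      linear_combination PowerSeries.X ^ 2 * f * e
    rw [this, map_add, ← hf, HahnSeries.ofPowerSeries_C]
    ring
  · rintro ⟨a, rfl⟩
    have : incl (PowerSeries.C (α : ℂ) * (1 + PowerSeries.X ^ 2 * a)) - HahnSeries.C (α : ℂ) =
        incl (PowerSeries.X ^ 2 * (PowerSeries.C (α : ℂ) * a)) := by
      rw [← HahnSeries.ofPowerSeries_C (Γ := ℤ), ← map_sub]
      congr 1
      ring
    rw [this]
    exact incl_X_pow_mem 2 _

theorem mem_I4 {g : LoopSL2} : g ∈ I4 ↔ ∃ α : ℂˣ,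
    g 0 0 - HahnSeries.C (α : ℂ) ∈ laurentGE 2 ∧ g 0 1 ∈ laurentGE 2 ∧ g 1 0 ∈ laurentGE 2 ∧
      g 1 1 - HahnSeries.C ((α⁻¹ : ℂˣ) : ℂ) ∈ laurentGE 2 := by
  constructor
  · rintro ⟨_, ⟨α, a, b, c, d, rfl⟩, hg⟩
    obtain ⟨h1, h2, h3, h4⟩ := loop_eq_map.mp hg
    refine ⟨α, (sub_C_mem_iff α).mpr ⟨a, h1⟩, ?_, ?_, (sub_C_mem_iff α⁻¹).mpr ⟨d, h4⟩⟩
    · rw [h2]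
      exact incl_X_pow_mem 2 b
    · rw [h3]
      exact incl_X_pow_mem 2 c
  · rintro ⟨α, h1, h2, h3, h4⟩
    obtain ⟨a, ha⟩ := (sub_C_mem_iff α).mp h1
    obtain ⟨b, hb⟩ := exists_incl_X_pow (k := 2) h2
    obtain ⟨c, hc⟩ := exists_incl_X_pow (k := 2) h3
    obtain ⟨d, hd⟩ := (sub_C_mem_iff α⁻¹).mp h4
    exact ⟨_, ⟨α, a, b, c, d, rfl⟩, loop_eq_map.mpr ⟨ha, hb, hc, hd⟩⟩

theorem mem_laurentGE_of_sub_C {k : ℤ} (hk : 0 ≤ k) {x : ℂ⸨X⸩} {r : ℂ}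
    (h : x - HahnSeries.C r ∈ laurentGE k) : x ∈ laurentGE 0 := by
  simpa using add_mem (laurentGE_mono hk h) (C_mem r)

theorem I4_le_I3 : I4 ≤ I3 := fun g hg => by
  obtain ⟨α, h1, h2, h3, h4⟩ := mem_I4.mp hg
  exact mem_I3.mpr ⟨mem_laurentGE_of_sub_C (by lia) h1, h2, h3,
    mem_laurentGE_of_sub_C (by lia) h4⟩

/-- The diagonal entries of a matrix in `I₃` are invertible power series. -/
theorem hasOrder_diag_of_mem_I3 {g : LoopSL2} (hg : g ∈ I3) :
    HasOrder 0 (g 0 0) ∧ HasOrder 0 (g 1 1) := by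
  obtain ⟨h1, h2, h3, h4⟩ := mem_I3.mp hg
  have h : HasOrder 0 (g 0 0 * g 1 1) := by
    refine hasOrder_one.of_sub_mem ?_
    -- The product b c lies in t⁴ ℂ[[t]], so a d has constant coefficient one.
    have e : g 0 0 * g 1 1 - 1 = g 0 1 * g 1 0 := by linear_combination det_loop g
    rw [e]
    exact mul_mem_laurentGE h2 h3 (by lia)
  have e := coeff_mul_of_mem h1 h4
  have h' := h.2
  rw [show (0 : ℤ) = 0 + 0 from rfl, e] at h'
  exact ⟨⟨h1, left_ne_zero_of_mul h'⟩, ⟨h4, right_ne_zero_of_mul h'⟩⟩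

/-! ### Points of the affine flag variety as balls in `ℂ((t))` -/

/-- The representative in the loop group of the point of the affine flag variety that corresponds
to the ball `s + t^N ℂ[[t]]` in `ℂ((t))`. -/
def ballRep (N : ℤ) (s : ℂ⸨X⸩) : LoopSL2 :=
  if N % 2 = 0 then upperRep (N / 2) (tpow (-(N / 2)) * s)
  else primeRep (N / 2) (-(tpow (-(N / 2)) * s))

/-- The point of the affine flag variety that corresponds to the ball `s + t^N ℂ[[t]]`. -/
def ball (N : ℤ) (s : ℂ⸨X⸩) : Flag := (ballRep N s : Flag)

theorem ballRep_even (n : ℤ) (s : ℂ⸨X⸩) : ballRep (2 * n) s = upperRep n (tpow (-n) * s) := by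
  have h : 2 * n / 2 = n := by lia
  rw [ballRep, if_pos (by lia), h]

theorem ballRep_odd (n : ℤ) (s : ℂ⸨X⸩) :
    ballRep (2 * n + 1) s = primeRep n (-(tpow (-n) * s)) := by
  have h : (2 * n + 1) / 2 = n := by lia
  rw [ballRep, if_neg (by lia), h]

theorem pt_eq_ball (n : ℤ) (p : ℂ⸨X⸩) : pt n p = ball (2 * n) (tpow n * p) := by
  rw [ball, ballRep_even, ← mul_assoc, tpow_mul_tpow, neg_add_cancel, tpow_zero, one_mul]
  rfl

/-- The center is the ratio of the entries of the first column, whose lower entry is -t^(-n); hence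
the sign. -/
theorem ptPrime_eq_ball (n : ℤ) (p : ℂ⸨X⸩) : ptPrime n p = ball (2 * n + 1) (-(tpow n * p)) := by
  have e : -(tpow (-n) * -(tpow n * p)) = p := by linear_combination p * tpow_mul_tpow_neg n
  rw [ball, ballRep_odd, e]
  rfl

theorem coe_inv_mul (g h : LoopSL2) :
    ((g⁻¹ * h : LoopSL2) : Matrix (Fin 2) (Fin 2) ℂ⸨X⸩) =
      !![g 1 1 * h 0 0 - g 0 1 * h 1 0, g 1 1 * h 0 1 - g 0 1 * h 1 1;
         g 0 0 * h 1 0 - g 1 0 * h 0 0, g 0 0 * h 1 1 - g 1 0 * h 0 1] := by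
  rw [Matrix.SpecialLinearGroup.coe_mul, Matrix.SpecialLinearGroup.coe_inv,
    Matrix.adjugate_fin_two]
  ext i j : 1
  fin_cases i <;> fin_cases j <;> simp [Matrix.mul_apply, Fin.sum_univ_two] <;> ring

theorem mk_eq_mk_iff (g h : LoopSL2) : (g : Flag) = (h : Flag) ↔
    g 1 1 * h 0 0 - g 0 1 * h 1 0 ∈ laurentGE 0 ∧ g 1 1 * h 0 1 - g 0 1 * h 1 1 ∈ laurentGE 0 ∧
    g 0 0 * h 1 0 - g 1 0 * h 0 0 ∈ laurentGE 1 ∧ g 0 0 * h 1 1 - g 1 0 * h 0 1 ∈ laurentGE 0 := by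
  rw [QuotientGroup.eq, mem_Iwahori, coe_inv_mul]
  simp

theorem tpow_mul_mem_iff {k l : ℤ} {x : ℂ⸨X⸩} :
    tpow k * x ∈ laurentGE l ↔ x ∈ laurentGE (l - k) := by
  constructor
  · intro h
    have h' := tpow_mul_mem (k := -k) h
    rw [← mul_assoc, tpow_mul_tpow, neg_add_cancel, tpow_zero, one_mul] at h'
    exact laurentGE_mono (by lia) h'
  · intro h
    exact laurentGE_mono (by lia) (tpow_mul_mem (k := k) h)

/-- The conditions on the entries of `g` for `g I` to be the point corresponding to the ball
`s + t^N ℂ[[t]]`. -/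
theorem mk_eq_ball_iff (g : LoopSL2) (N : ℤ) (s : ℂ⸨X⸩) : (g : Flag) = ball N s ↔
    g 1 0 ∈ laurentGE (1 - N + N / 2) ∧ g 1 1 ∈ laurentGE (-(N / 2)) ∧
    g 0 0 - s * g 1 0 ∈ laurentGE (N - N / 2) ∧ g 0 1 - s * g 1 1 ∈ laurentGE (N / 2) := by
  rw [eq_comm, ball, mk_eq_mk_iff]
  obtain ⟨n, rfl | rfl⟩ := Int.even_or_odd' N
  · have h : 2 * n / 2 = n := by lia
    rw [ballRep_even, h]
    simp only [upperRep, Matrix.of_apply, Matrix.cons_val_zero, Matrix.cons_val_one,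
      Matrix.cons_val', Matrix.cons_val_fin_one, zero_mul, sub_zero, mul_assoc, ← mul_sub,
      tpow_mul_mem_iff]
    rw [show (1 : ℤ) - n = 1 - 2 * n + n by ring, show (0 : ℤ) - n = -n by ring,
      show (0 : ℤ) - -n = n by ring, show 2 * n - n = n by ring]
    tauto
  · have h : (2 * n + 1) / 2 = n := by lia
    rw [ballRep_odd, h]
    have e1 (y : ℂ⸨X⸩) : 0 * y - tpow n * g 1 0 = -(tpow n * g 1 0) := by ring
    have e2 (y : ℂ⸨X⸩) : 0 * y - tpow n * g 1 1 = -(tpow n * g 1 1) := by ring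
    have e3 (x y : ℂ⸨X⸩) : -(tpow (-n) * s) * x - -tpow (-n) * y = tpow (-n) * (y - s * x) := by
      ring
    simp only [primeRep, Matrix.of_apply, Matrix.cons_val_zero, Matrix.cons_val_one,
      Matrix.cons_val', Matrix.cons_val_fin_one, e1, e2, e3, neg_mem_iff, tpow_mul_mem_iff]
    rw [show 1 - (2 * n + 1) + n = 0 - n by ring, show -n = 0 - n by ring,
      show 2 * n + 1 - n = 1 - (0 - n) by ring, show (n : ℤ) = 0 - (0 - n) by ring]
    simp only [zero_sub, neg_neg]

theorem mk_ballRep (N : ℤ) (s : ℂ⸨X⸩) : (ballRep N s : Flag) = ball N s := rfl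

theorem ball_eq_ball_iff (N : ℤ) (s s' : ℂ⸨X⸩) :
    ball N s = ball N s' ↔ s - s' ∈ laurentGE N := by
  rw [ball, ball, mk_eq_mk_iff]
  obtain ⟨n, rfl | rfl⟩ := Int.even_or_odd' N
  · rw [ballRep_even, ballRep_even]
    have e : tpow (-n) * (tpow (-n) * s') - tpow (-n) * s * tpow (-n) =
      -(tpow (-n) * (tpow (-n) * (s - s'))) := by ring
    simp [upperRep, tpow_mul_tpow, e, tpow_mul_mem_iff, zero_mem, -HahnSeries.single_mul_single,
      show n - -n = 2 * n by ring, one_mem_laurentGE]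
  · rw [ballRep_odd, ballRep_odd]
    have e : -(tpow (-n) * s) * -tpow (-n) - -tpow (-n) * -(tpow (-n) * s') =
      (tpow (-n) * (tpow (-n) * (s - s'))) := by ring
    have e' : -tpow (-n) * tpow n = -1 := by linear_combination -tpow_mul_tpow_neg n
    simp [primeRep, e, e', tpow_mul_mem_iff, zero_mem, -HahnSeries.single_mul_single, tpow_mem,
      one_mem_laurentGE, show 1 + n + n = 2 * n + 1 by ring]

/-- The bottom entry of smaller order decides: if it is g₁₁, the exponent is even and the center is
the ratio of the second column; if it is g₁₀ (ties included), the exponent is odd and the first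
column is used. By the determinant condition the deviation of the other column is ± the inverse of
that entry, so it has the required order. -/
theorem exists_eq_ball (q : Flag) : ∃ N s, q = ball N s := by
  induction q using QuotientGroup.induction_on with
  | H g =>
    have hdet := det_loop g
    have key : g 1 1 ≠ 0 ∧ (∀ n, HasOrder n (g 1 1) → g 1 0 ∈ laurentGE (n + 1)) ∨
        ∃ n, HasOrder n (g 1 0) ∧ g 1 1 ∈ laurentGE n := by
      by_cases hc : g 1 0 = 0
      · refine Or.inl ⟨?_, fun n _ => hc ▸ zero_mem _⟩
        intro hd
        rw [hc, hd, mul_zero, mul_zero, sub_zero] at hdet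
        exact zero_ne_one hdet
      · obtain ⟨m, hm⟩ := exists_hasOrder hc
        by_cases hd : g 1 1 ∈ laurentGE m
        · exact Or.inr ⟨m, hm, hd⟩
        · refine Or.inl ⟨?_, fun n hn => ?_⟩
          · intro h0
            exact hd (h0 ▸ zero_mem _)
          · refine laurentGE_mono ?_ hm.1
            by_contra! hlt
            exact hd (laurentGE_mono (by lia) hn.1)
    rcases key with ⟨hd, h⟩ | ⟨n, hn, h⟩
    · obtain ⟨n, hn⟩ := exists_hasOrder hd
      refine ⟨2 * (-n), g 0 1 / g 1 1, (mk_eq_ball_iff _ _ _).mpr ?_⟩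
      rw [show 2 * (-n) / 2 = -n by lia]
      refine ⟨laurentGE_mono (by lia) (h n hn), laurentGE_mono (by lia) hn.1, ?_, ?_⟩
      · have e : g 0 0 - g 0 1 / g 1 1 * g 1 0 = (g 1 1)⁻¹ := by
          field_simp
          linear_combination hdet
        rw [e]
        exact laurentGE_mono (by lia) hn.inv.1
      · rw [div_mul_cancel₀ _ hd, sub_self]
        exact zero_mem _
    · have hc := hn.ne_zero
      refine ⟨2 * (-n) + 1, g 0 0 / g 1 0, (mk_eq_ball_iff _ _ _).mpr ?_⟩
      rw [show (2 * (-n) + 1) / 2 = -n by lia]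
      refine ⟨laurentGE_mono (by lia) hn.1, laurentGE_mono (by lia) h, ?_, ?_⟩
      · rw [div_mul_cancel₀ _ hc, sub_self]
        exact zero_mem _
      · have e : g 0 1 - g 0 0 / g 1 0 * g 1 1 = -(g 1 0)⁻¹ := by
          field_simp
          linear_combination -hdet
        rw [e]
        exact laurentGE_mono (by lia) hn.inv.neg.1

theorem coe_mul_fin_two (g h : LoopSL2) :
    ((g * h : LoopSL2) : Matrix (Fin 2) (Fin 2) ℂ⸨X⸩) =
      !![g 0 0 * h 0 0 + g 0 1 * h 1 0, g 0 0 * h 0 1 + g 0 1 * h 1 1;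
         g 1 0 * h 0 0 + g 1 1 * h 1 0, g 1 0 * h 0 1 + g 1 1 * h 1 1] := by
  rw [Matrix.SpecialLinearGroup.coe_mul]
  ext i j : 1
  fin_cases i <;> fin_cases j <;> simp [Matrix.mul_apply, Fin.sum_univ_two]

/-- The loop group acts on balls that stay away from the pole by Möbius transformations. -/
theorem smul_ball {h : LoopSL2} {N k : ℤ} {s : ℂ⸨X⸩} (hj : HasOrder k (h 1 0 * s + h 1 1))
    (hc : h 1 0 ∈ laurentGE (k + 1 - N)) :
    h • ball N s = ball (N - 2 * k) ((h 0 0 * s + h 0 1) / (h 1 0 * s + h 1 1)) := by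
  have hdet := det_loop h
  have hj0 := hj.ne_zero
  obtain ⟨g, hg⟩ : ∃ g, g = ballRep N s := ⟨_, rfl⟩
  have hgs : (g : Flag) = ball N s := by rw [hg, mk_ballRep]
  rw [← hgs]
  change ((h * g : LoopSL2) : Flag) = _
  obtain ⟨h1, h2, h3, h4⟩ := (mk_eq_ball_iff _ _ _).mp hgs
  have e : (N - 2 * k) / 2 = N / 2 - k := by lia
  rw [mk_eq_ball_iff, coe_mul_fin_two, e]
  simp only [Matrix.of_apply, Matrix.cons_val_zero, Matrix.cons_val_one, Matrix.cons_val',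
    Matrix.cons_val_fin_one]
  generalize g 0 0 = x at *
  generalize g 0 1 = y at *
  generalize g 1 0 = c at *
  generalize g 1 1 = d at *
  generalize h 0 0 = A at *
  generalize h 0 1 = B at *
  generalize h 1 0 = C at *
  generalize h 1 1 = D at *
  -- For a column (x, c), the new lower entry is C times the deviation x - s c plus (C s + D) c, and
  -- the new deviation is the old one divided by C s + D. The hypothesis on C says that C z + D
  -- keeps order k on the whole ball, so the exponent drops by 2 k.
  have e1 (x c : ℂ⸨X⸩) : C * x + D * c = C * (x - s * c) + (C * s + D) * c := by ring
  have e2 (x c : ℂ⸨X⸩) : A * x + B * c - (A * s + B) / (C * s + D) * (C * x + D * c) =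
      (C * s + D)⁻¹ * (x - s * c) := by
    rw [eq_inv_mul_iff_mul_eq₀ hj0, mul_sub, ← mul_assoc, mul_div_cancel₀ _ hj0]
    linear_combination (x - s * c) * hdet
  rw [e2, e2, e1, e1]
  refine ⟨add_mem (mul_mem_laurentGE hc h3 (by lia)) (mul_mem_laurentGE hj.1 h1 (by lia)),
    add_mem (mul_mem_laurentGE hc h4 (by lia)) (mul_mem_laurentGE hj.1 h2 (by lia)),
    mul_mem_laurentGE hj.inv.1 h3 (by lia), mul_mem_laurentGE hj.inv.1 h4 (by lia)⟩

/-- The matrix `(0, 1; -1, 0)`. -/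
def weyl : LoopSL2 := primeRep 0 0

theorem weyl_coe : (weyl : Matrix (Fin 2) (Fin 2) ℂ⸨X⸩) = !![0, 1; -1, 0] := rfl

/-- The nontrivial element of the finite Weyl group acts by `s ↦ -s⁻¹` on balls not containing
zero. -/
theorem weyl_smul_ball {N k : ℤ} {s : ℂ⸨X⸩} (hs : HasOrder k s) (hk : k < N) :
    weyl • ball N s = ball (N - 2 * k) (-s⁻¹) := by
  have e : weyl 1 0 * s + weyl 1 1 = -s := by
    simp only [weyl_coe, Matrix.of_apply, Matrix.cons_val_zero, Matrix.cons_val_one,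
      Matrix.cons_val', Matrix.cons_val_fin_one]
    ring
  rw [smul_ball (k := k)]
  · rw [e]
    congr 1
    simp only [weyl_coe, Matrix.of_apply, Matrix.cons_val_zero, Matrix.cons_val_one,
      Matrix.cons_val', Matrix.cons_val_fin_one]
    ring
  · rw [e]
    exact hs.neg
  · simp only [weyl_coe, Matrix.of_apply, Matrix.cons_val_zero, Matrix.cons_val_one]
    exact laurentGE_mono (by lia) (neg_mem one_mem_laurentGE)

/-- Here the pole of s ↦ -s⁻¹ lies in the ball, so `smul_ball` does not apply. The edge joining t^N
ℂ[[t]] to t^(N-1) ℂ[[t]] is reversed by inversion, and its smaller end becomes t^(1-N) ℂ[[t]]; hence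
1 - N and not -N. -/
theorem weyl_smul_ball_zero (N : ℤ) : weyl • ball N 0 = ball (1 - N) 0 := by
  obtain ⟨g, hg⟩ : ∃ g, g = ballRep N 0 := ⟨_, rfl⟩
  have hgs : (g : Flag) = ball N 0 := by rw [hg, mk_ballRep]
  rw [← hgs]
  change ((weyl * g : LoopSL2) : Flag) = _
  obtain ⟨h1, h2, h3, h4⟩ := (mk_eq_ball_iff _ _ _).mp hgs
  rw [mk_eq_ball_iff, coe_mul_fin_two, weyl_coe]
  simp only [Matrix.of_apply, Matrix.cons_val_zero, Matrix.cons_val_one, Matrix.cons_val',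
    Matrix.cons_val_fin_one, zero_mul, sub_zero, zero_add, one_mul, add_zero] at *
  have e (x : ℂ⸨X⸩) : -1 * x = -x := by ring
  rw [e, e]
  refine ⟨neg_mem (laurentGE_mono ?_ h3), neg_mem (laurentGE_mono ?_ h4), laurentGE_mono ?_ h1,
    laurentGE_mono ?_ h2⟩ <;> lia

/-- The square of `weyl` is -1, which is central and lies in I. -/
theorem weyl_smul_weyl_smul (q : Flag) : weyl • weyl • q = q := by
  induction q using QuotientGroup.induction_on with
  | H g =>
    change ((weyl * (weyl * g) : LoopSL2) : Flag) = _
    have e : weyl * (weyl * g) = -g := by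
      refine Matrix.SpecialLinearGroup.ext _ _ fun i j => ?_
      rw [coe_mul_fin_two, coe_mul_fin_two, weyl_coe, Matrix.SpecialLinearGroup.coe_neg]
      fin_cases i <;> fin_cases j <;>
        simp only [Matrix.of_apply, Matrix.cons_val_zero, Matrix.cons_val_one, Matrix.cons_val',
          Matrix.cons_val_fin_one, Fin.zero_eta, Fin.mk_one, Matrix.neg_apply] <;> ring
    rw [e, eq_comm, mk_eq_mk_iff]
    have hdet := det_loop g
    simp only [Matrix.SpecialLinearGroup.coe_neg, Matrix.neg_apply]
    refine ⟨?_, ?_, ?_, ?_⟩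
    · have : g 1 1 * -g 0 0 - g 0 1 * -g 1 0 = -1 := by linear_combination -hdet
      rw [this]
      exact neg_mem one_mem_laurentGE
    · have : g 1 1 * -g 0 1 - g 0 1 * -g 1 1 = 0 := by ring
      rw [this]
      exact zero_mem _
    · have : g 0 0 * -g 1 0 - g 1 0 * -g 0 0 = 0 := by ring
      rw [this]
      exact zero_mem _
    · have : g 0 0 * -g 1 1 - g 1 0 * -g 0 1 = -1 := by linear_combination -hdet
      rw [this]
      exact neg_mem one_mem_laurentGE

/-! ### Loop rotation acting on balls -/

theorem rescaleT_mem {γ : ℂˣ} {k : ℤ} {x : ℂ⸨X⸩} (hx : x ∈ laurentGE k) :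
    rescaleT γ x ∈ laurentGE k := fun j hj => by
  rw [rescaleT_coeff, hx j hj, mul_zero]

theorem rescaleT_sub_mul (γ : ℂˣ) (x y z : ℂ⸨X⸩) :
    rescaleT γ x - rescaleT γ y * rescaleT γ z = rescaleT γ (x - y * z) :=
  (by simp : rescaleTHom γ x - rescaleTHom γ y * rescaleTHom γ z = rescaleTHom γ (x - y * z))

theorem rotFlag_ball (γ : ℂˣ) (N : ℤ) (s : ℂ⸨X⸩) :
    rotFlag γ (ball N s) = ball N (rescaleT γ s) := by
  obtain ⟨g, hg⟩ : ∃ g, g = ballRep N s := ⟨_, rfl⟩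
  have hgs : (g : Flag) = ball N s := by rw [hg, mk_ballRep]
  rw [← hgs, rotFlag_mk]
  obtain ⟨h1, h2, h3, h4⟩ := (mk_eq_ball_iff _ _ _).mp hgs
  rw [mk_eq_ball_iff]
  simp only [rot_apply, rescaleT_sub_mul]
  exact ⟨rescaleT_mem h1, rescaleT_mem h2, rescaleT_mem h3, rescaleT_mem h4⟩

/-! ### Criteria for orbits -/

theorem isOrbit_of_forall {H : Subgroup LoopSL2} {X : Set Flag} (x : Flag)
    (htrans : ∀ y ∈ X, ∃ h ∈ H, h • x = y) (hinv : ∀ h ∈ H, h • x ∈ X) : IsOrbit H X := by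
  refine ⟨x, Set.Subset.antisymm (fun y hy => ?_) ?_⟩
  · obtain ⟨h, hh, rfl⟩ := htrans y hy
    exact ⟨⟨h, hh⟩, rfl⟩
  · rintro _ ⟨h, rfl⟩
    exact hinv h h.2

theorem isOrbit_I4rot_of_forall {X : Set Flag} (x : Flag)
    (htrans : ∀ y ∈ X, ∃ h ∈ I4, ∃ γ, h • rotFlag γ x = y)
    (hinv : ∀ h ∈ I4, ∀ γ, h • rotFlag γ x ∈ X) : IsOrbit I4rot X := by
  refine ⟨x, Set.Subset.antisymm (fun y hy => ?_) ?_⟩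
  · obtain ⟨h, hh, γ, rfl⟩ := htrans y hy
    exact ⟨⟨⟨h, γ⟩, hh⟩, rfl⟩
  · rintro _ ⟨h, rfl⟩
    exact hinv _ h.2 _

theorem rotFlag_one (q : Flag) : rotFlag 1 q = q := by
  induction q using QuotientGroup.induction_on with
  | H g =>
    rw [rotFlag_mk, map_one]
    rfl

theorem IsOrbit.rot_of_invariant {X : Set Flag} (hX : IsOrbit I4 X)
    (hrot : ∀ γ, ∀ q ∈ X, rotFlag γ q ∈ X) : IsOrbit I4rot X := by
  obtain ⟨x, rfl⟩ := hX
  refine isOrbit_I4rot_of_forall x ?_ fun h hh γ =>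
    MulAction.mem_orbit_of_mem_orbit (⟨h, hh⟩ : I4) (hrot γ x (MulAction.mem_orbit_self x))
  rintro _ ⟨h, rfl⟩
  refine ⟨h, h.2, 1, ?_⟩
  rw [rotFlag_one]
  rfl

/-- `X` is an orbit of each of the groups `I₃`, `I₄`, `I₄^rot`. -/
def IsCommonOrbit (X : Set Flag) : Prop := IsOrbit I3 X ∧ IsOrbit I4 X ∧ IsOrbit I4rot X

/-- Transitivity is asked of the smaller group I₄ and invariance of the larger group I₃, so both
properties hold for both groups. -/
theorem isCommonOrbit_of_forall {X : Set Flag} (x : Flag)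
    (htrans : ∀ y ∈ X, ∃ h ∈ I4, h • x = y) (hinv : ∀ h ∈ I3, h • x ∈ X)
    (hrot : ∀ γ, ∀ q ∈ X, rotFlag γ q ∈ X) : IsCommonOrbit X := by
  have h4 : IsOrbit I4 X := isOrbit_of_forall x htrans fun h hh => hinv h (I4_le_I3 hh)
  refine ⟨isOrbit_of_forall x (fun y hy => ?_) hinv, h4, h4.rot_of_invariant hrot⟩
  obtain ⟨h, hh, e⟩ := htrans y hy
  exact ⟨h, I4_le_I3 hh, e⟩

/-! ### Conjugation by the nontrivial element of the finite Weyl group -/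

/-- The matrix `(d, -c; -b, a)`, which is the conjugate of `g = (a, b; c, d)` by `weyl`. -/
def weylConj (g : LoopSL2) : LoopSL2 :=
  ⟨!![g 1 1, -g 1 0; -g 0 1, g 0 0], by
    rw [Matrix.det_fin_two_of]
    linear_combination det_loop g⟩

theorem weyl_mul (g : LoopSL2) : weyl * g = weylConj g * weyl := by
  refine Matrix.SpecialLinearGroup.ext _ _ fun i j => ?_
  rw [coe_mul_fin_two, coe_mul_fin_two, weyl_coe]
  fin_cases i <;> fin_cases j <;>
    simp only [weylConj, Matrix.of_apply, Matrix.cons_val_zero, Matrix.cons_val_one,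
      Matrix.cons_val', Matrix.cons_val_fin_one, Fin.zero_eta, Fin.mk_one] <;> ring

theorem weylConj_mem_I3 {g : LoopSL2} (hg : g ∈ I3) : weylConj g ∈ I3 := by
  obtain ⟨h1, h2, h3, h4⟩ := mem_I3.mp hg
  exact mem_I3.mpr ⟨h4, neg_mem h3, neg_mem h2, h1⟩

theorem weylConj_mem_I4 {g : LoopSL2} (hg : g ∈ I4) : weylConj g ∈ I4 := by
  obtain ⟨α, h1, h2, h3, h4⟩ := mem_I4.mp hg
  exact mem_I4.mpr ⟨α⁻¹, h4, neg_mem h3, neg_mem h2, by rwa [inv_inv]⟩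

theorem weyl_smul_smul (g : LoopSL2) (q : Flag) : weyl • g • q = weylConj g • weyl • q := by
  rw [← mul_smul, weyl_mul, mul_smul]

/-- The translate of a set of flags by `weyl`. -/
def weylImage (X : Set Flag) : Set Flag := (fun q => weyl • q) '' X

theorem IsOrbit.weylImage {H : Subgroup LoopSL2} (hH : ∀ h ∈ H, weylConj h ∈ H) {X : Set Flag}
    (hX : IsOrbit H X) : IsOrbit H (weylImage X) := by
  obtain ⟨x, rfl⟩ := hX
  refine isOrbit_of_forall (weyl • x) ?_ ?_
  · rintro _ ⟨_, ⟨h, rfl⟩, rfl⟩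
    exact ⟨_, hH h h.2, (weyl_smul_smul _ _).symm⟩
  · intro h hh
    refine ⟨_, ⟨⟨_, hH h hh⟩, rfl⟩, ?_⟩
    change weyl • weylConj h • x = h • weyl • x
    -- Since `weyl` acts as an involution, conjugation by it can be read in either direction.
    rw [← weyl_smul_weyl_smul x, ← weyl_smul_smul, weyl_smul_weyl_smul, weyl_smul_weyl_smul]

theorem rotFlag_weyl_smul (γ : ℂˣ) (q : Flag) : rotFlag γ (weyl • q) = weyl • rotFlag γ q := by
  induction q using QuotientGroup.induction_on with
  | H g =>
    change ((rot γ (weyl * g) : LoopSL2) : Flag) = ((weyl * rot γ g : LoopSL2) : Flag)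
    have e : rot γ weyl = weyl := by
      refine Matrix.SpecialLinearGroup.ext _ _ fun i j => ?_
      rw [rot_apply, weyl_coe]
      change rescaleTHom γ _ = _
      fin_cases i <;> fin_cases j <;> simp
    rw [map_mul, e]

theorem IsCommonOrbit.weylImage {X : Set Flag} (hX : IsCommonOrbit X)
    (hrot : ∀ γ, ∀ q ∈ X, rotFlag γ q ∈ X) : IsCommonOrbit (weylImage X) := by
  have h4 : IsOrbit I4 (AffineFlag.weylImage X) := hX.2.1.weylImage fun _ => weylConj_mem_I4
  refine ⟨hX.1.weylImage fun _ => weylConj_mem_I3, h4, h4.rot_of_invariant ?_⟩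
  rintro γ _ ⟨q, hq, rfl⟩
  exact ⟨_, hrot γ q hq, (rotFlag_weyl_smul γ q).symm⟩

/-! ### Translations and dilations of balls -/

/-- The matrix `(1, b; 0, 1)`. -/
def translation (b : ℂ⸨X⸩) : LoopSL2 := ⟨!![1, b; 0, 1], by simp [Matrix.det_fin_two_of]⟩

theorem translation_mem {b : ℂ⸨X⸩} (hb : b ∈ laurentGE 2) : translation b ∈ I4 :=
  mem_I4.mpr ⟨1, by simp [translation, zero_mem], hb, zero_mem _, by simp [translation, zero_mem]⟩

theorem translation_smul_ball (b : ℂ⸨X⸩) (N : ℤ) (s : ℂ⸨X⸩) :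
    translation b • ball N s = ball N (s + b) := by
  have e : translation b 1 0 * s + translation b 1 1 = 1 := by
    simp [translation]
  rw [smul_ball (k := 0) (by rw [e]; exact hasOrder_one) (zero_mem _), e]
  simp [translation]

/-- The matrix `diag(a, a⁻¹)`. -/
def dilation (a : ℂ⸨X⸩) (ha : a ≠ 0) : LoopSL2 :=
  ⟨!![a, 0; 0, a⁻¹], by simp [Matrix.det_fin_two_of, ha]⟩

theorem dilation_mem_I3 {a : ℂ⸨X⸩} (ha : HasOrder 0 a) : dilation a ha.ne_zero ∈ I3 :=
  mem_I3.mpr ⟨ha.1, zero_mem _, zero_mem _, ha.inv.1⟩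

theorem dilation_C_mem_I4 {r : ℂ} (hr : r ≠ 0) : dilation (HahnSeries.C r) (hasOrder_C hr).ne_zero ∈ I4 := by
  refine mem_I4.mpr ⟨Units.mk0 r hr, ?_, zero_mem _, zero_mem _, ?_⟩
  · simp [dilation, zero_mem]
  · simp [dilation, zero_mem]

theorem dilation_smul_ball {a : ℂ⸨X⸩} (ha : HasOrder 0 a) (N : ℤ) (s : ℂ⸨X⸩) :
    dilation a ha.ne_zero • ball N s = ball N (a ^ 2 * s) := by
  have e : dilation a ha.ne_zero 1 0 * s + dilation a ha.ne_zero 1 1 = a⁻¹ := by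
    simp [dilation]
  rw [smul_ball (k := 0) (by rw [e]; exact ha.inv) (zero_mem _), e]
  simp only [dilation, Matrix.of_apply, Matrix.cons_val_zero, Matrix.cons_val_one,
    Matrix.cons_val', Matrix.cons_val_fin_one, mul_zero, sub_zero]
  congr 1
  rw [div_inv_eq_mul]
  ring

/-- Translations by `t² ℂ[[t]]` and dilations by constants identify two balls whose centers agree
modulo `t²` up to a constant. -/
theorem exists_I4_smul_ball {N : ℤ} {s s' : ℂ⸨X⸩} {r : ℂ} (hr : r ≠ 0)
    (h : s' - HahnSeries.C r * s ∈ laurentGE 2) : ∃ g ∈ I4, g • ball N s = ball N s' := by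
  obtain ⟨α, hα⟩ := IsAlgClosed.exists_pow_nat_eq r two_pos
  have h0 : α ≠ 0 := by
    rintro rfl
    exact hr (by simp [← hα])
  refine ⟨_, mul_mem (translation_mem h) (dilation_C_mem_I4 h0), ?_⟩
  rw [mul_smul, dilation_smul_ball (hasOrder_C h0), translation_smul_ball, ← map_pow, hα]
  congr 1
  ring

/-! ### Möbius action of I₃ and I₄ on integral centers -/

theorem I3_hasOrder_denom {h : LoopSL2} (hh : h ∈ I3) {s : ℂ⸨X⸩} (hs : s ∈ laurentGE 0) :
    HasOrder 0 (h 1 0 * s + h 1 1) := by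
  refine (hasOrder_diag_of_mem_I3 hh).2.of_sub_mem ?_
  rw [add_sub_cancel_right]
  exact mul_mem_laurentGE (mem_I3.mp hh).2.2.1 hs (by lia)

/-- Since c ∈ t² ℂ[[t]], the denominator is a unit, so the exponent N is preserved. -/
theorem I3_smul_ball {h : LoopSL2} (hh : h ∈ I3) {N : ℤ} (hN : 0 ≤ N) {s : ℂ⸨X⸩}
    (hs : s ∈ laurentGE 0) :
    h • ball N s = ball N ((h 0 0 * s + h 0 1) / (h 1 0 * s + h 1 1)) := by
  rw [smul_ball (I3_hasOrder_denom hh hs) (laurentGE_mono (by lia) (mem_I3.mp hh).2.2.1), mul_zero,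
    sub_zero]

theorem I3_mobius_mem {h : LoopSL2} (hh : h ∈ I3) {s : ℂ⸨X⸩} (hs : s ∈ laurentGE 2) :
    (h 0 0 * s + h 0 1) / (h 1 0 * s + h 1 1) ∈ laurentGE 2 := by
  obtain ⟨h1, h2, h3, h4⟩ := mem_I3.mp hh
  rw [div_eq_mul_inv]
  exact mul_mem_laurentGE (add_mem (mul_mem_laurentGE h1 hs (by lia)) h2)
    (I3_hasOrder_denom hh (laurentGE_mono (by lia) hs)).inv.1 (by lia)

/-- The bound k ≤ 1 keeps the leading term of a s out of reach of b ∈ t² ℂ[[t]]. -/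
theorem I3_mobius_hasOrder {h : LoopSL2} (hh : h ∈ I3) {k : ℤ} (hk : 0 ≤ k) (hk' : k ≤ 1)
    {s : ℂ⸨X⸩} (hs : HasOrder k s) :
    HasOrder k ((h 0 0 * s + h 0 1) / (h 1 0 * s + h 1 1)) := by
  obtain ⟨h1, h2, h3, h4⟩ := mem_I3.mp hh
  have e := ((((hasOrder_diag_of_mem_I3 hh).1.mul hs).add_of_mem
    (laurentGE_mono (by lia) h2)).mul (I3_hasOrder_denom hh (laurentGE_mono hk hs.1)).inv)
  rw [div_eq_mul_inv]
  simpa using e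

/-- Modulo t² an element of I₄ is diag(α, α⁻¹), so it multiplies every integral center by the same
constant α². -/
theorem I4_mobius {h : LoopSL2} (hh : h ∈ I4) : ∃ r : ℂ, r ≠ 0 ∧ ∀ s ∈ laurentGE 0,
    (h 0 0 * s + h 0 1) / (h 1 0 * s + h 1 1) - HahnSeries.C r * s ∈ laurentGE 2 := by
  have hh3 := I4_le_I3 hh
  obtain ⟨α, h1, h2, h3, h4⟩ := mem_I4.mp hh
  refine ⟨(α : ℂ) ^ 2, by simp, fun s hs => ?_⟩
  have hj := I3_hasOrder_denom hh3 hs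
  have hα : (HahnSeries.C (α : ℂ) : ℂ⸨X⸩) * HahnSeries.C ((α⁻¹ : ℂˣ) : ℂ) = 1 := by
    rw [← map_mul, Units.mul_inv, map_one]
  -- After clearing the denominator the main terms cancel because α² α⁻¹ = α. Each remaining term
  -- contains one of a - α, b, c, d - α⁻¹, all of which lie in t² ℂ[[t]].
  have e : (h 0 0 * s + h 0 1) / (h 1 0 * s + h 1 1) - HahnSeries.C ((α : ℂ) ^ 2) * s =
      (h 1 0 * s + h 1 1)⁻¹ * ((h 0 0 - HahnSeries.C (α : ℂ)) * s + h 0 1 -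
        HahnSeries.C ((α : ℂ) ^ 2) * s * (h 1 0 * s) -
        HahnSeries.C ((α : ℂ) ^ 2) * s * (h 1 1 - HahnSeries.C ((α⁻¹ : ℂˣ) : ℂ))) := by
    rw [eq_inv_mul_iff_mul_eq₀ hj.ne_zero, mul_sub, mul_div_cancel₀ _ hj.ne_zero, map_pow]
    linear_combination -HahnSeries.C (α : ℂ) * s * hα
  have hC : HahnSeries.C ((α : ℂ) ^ 2) * s ∈ laurentGE 0 :=
    mul_mem_laurentGE (C_mem _) hs (by lia)
  rw [e]
  refine mul_mem_laurentGE hj.inv.1 (sub_mem (sub_mem (add_mem ?_ h2) ?_) ?_) (k := -0) (l := 2)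
    (by lia)
  · exact mul_mem_laurentGE h1 hs (by lia)
  · exact mul_mem_laurentGE hC (mul_mem_laurentGE h3 hs le_rfl) (by lia)
  · exact mul_mem_laurentGE hC h4 (by lia)

/-! ### Orbits of balls around integral points -/

/-- The set of all flags that correspond to balls with exponent `N` and center in `S`. -/
def ballsAt (N : ℤ) (S : Set ℂ⸨X⸩) : Set Flag := ball N '' S

theorem rotFlag_mem_ballsAt {N : ℤ} {S : Set ℂ⸨X⸩} (hS : ∀ γ, ∀ s ∈ S, rescaleT γ s ∈ S) (γ : ℂˣ) :
    ∀ q ∈ ballsAt N S, rotFlag γ q ∈ ballsAt N S := by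
  rintro _ ⟨s, hs, rfl⟩
  exact ⟨_, hS γ s hs, (rotFlag_ball γ N s).symm⟩

theorem coeff_rescaleT_eq_zero {γ : ℂˣ} {s : ℂ⸨X⸩} {k : ℤ} :
    (rescaleT γ s).coeff k = 0 ↔ s.coeff k = 0 := by
  rw [rescaleT_coeff, mul_eq_zero, or_iff_right (Units.ne_zero _)]

theorem HasOrder.rescaleT {k : ℤ} {s : ℂ⸨X⸩} (γ : ℂˣ) (hs : HasOrder k s) :
    HasOrder k (rescaleT γ s) :=
  ⟨rescaleT_mem hs.1, coeff_rescaleT_eq_zero.not.mpr hs.2⟩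

theorem rotFlag_mem_ballsAt_laurentGE {N k : ℤ} (γ : ℂˣ) :
    ∀ q ∈ ballsAt N (laurentGE k), rotFlag γ q ∈ ballsAt N (laurentGE k) :=
  rotFlag_mem_ballsAt (fun _ _ hs => rescaleT_mem hs) γ

theorem rotFlag_mem_ballsAt_hasOrder {N k : ℤ} (γ : ℂˣ) :
    ∀ q ∈ ballsAt N {s | HasOrder k s}, rotFlag γ q ∈ ballsAt N {s | HasOrder k s} :=
  rotFlag_mem_ballsAt (fun γ s (hs : HasOrder k s) => (hs.rescaleT γ : HasOrder k _)) γ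

theorem isCommonOrbit_laurentGE_two {N : ℤ} (hN : 0 ≤ N) :
    IsCommonOrbit (ballsAt N (laurentGE 2)) := by
  refine isCommonOrbit_of_forall (ball N 0) ?_ ?_ rotFlag_mem_ballsAt_laurentGE
  · rintro _ ⟨s, hs, rfl⟩
    refine exists_I4_smul_ball one_ne_zero ?_
    rwa [mul_zero, sub_zero]
  · intro h hh
    exact ⟨_, I3_mobius_mem hh (zero_mem _), (I3_smul_ball hh hN (zero_mem _)).symm⟩

/-- Modulo t² the center is s₁ t, and a dilation by a constant square root of s₁ reaches it from t.
-/
theorem isCommonOrbit_hasOrder_one {N : ℤ} (hN : 0 ≤ N) :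
    IsCommonOrbit (ballsAt N {s | HasOrder 1 s}) := by
  refine isCommonOrbit_of_forall (ball N (tpow 1)) ?_ ?_ rotFlag_mem_ballsAt_hasOrder
  · rintro _ ⟨s, hs, rfl⟩
    refine exists_I4_smul_ball hs.2 ?_
    refine mem_laurentGE_succ (sub_mem hs.1 (mul_mem_laurentGE (C_mem _) (tpow_mem 1) (by lia))) ?_
    rw [HahnSeries.coeff_sub, coeff_C_mul, coeff_tpow, if_pos rfl, mul_one, sub_self]
  · intro h hh
    exact ⟨_, I3_mobius_hasOrder hh (by lia) le_rfl (hasOrder_tpow 1),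
      (I3_smul_ball hh hN (laurentGE_mono (by lia) (tpow_mem 1))).symm⟩

theorem isOrbit_I3_hasOrder_zero {N : ℤ} (hN : 0 ≤ N) :
    IsOrbit I3 (ballsAt N {s | HasOrder 0 s}) := by
  refine isOrbit_of_forall (ball N 1) ?_ ?_
  · rintro _ ⟨s, hs, rfl⟩
    obtain ⟨α, hα⟩ := IsAlgClosed.exists_pow_nat_eq (s.coeff 0) two_pos
    have h0 : α ≠ 0 := by
      rintro rfl
      exact hs.2 (by simp [← hα])
    -- A square root of s modulo t²: with α² = s₀, the coefficient β of t has to satisfy 2 α β = s₁.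
    -- The surplus β² t² is absorbed by a translation.
    have ha : HasOrder 0 (HahnSeries.C α + HahnSeries.C (s.coeff 1 / (2 * α)) * tpow 1) :=
      (hasOrder_C h0).add_of_mem (mul_mem_laurentGE (C_mem _) (tpow_mem 1) (by lia))
    set a := HahnSeries.C α + HahnSeries.C (s.coeff 1 / (2 * α)) * tpow 1 with hadef
    have hmem : s - a ^ 2 * 1 ∈ laurentGE 2 := by
      have e : a ^ 2 * 1 = HahnSeries.C (s.coeff 0) + HahnSeries.C (s.coeff 1) * tpow 1 +
          HahnSeries.C ((s.coeff 1 / (2 * α)) ^ 2) * tpow 2 := by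
        have e1 : s.coeff 1 = 2 * α * (s.coeff 1 / (2 * α)) := by field_simp
        have e2 : (HahnSeries.C (s.coeff 1) : ℂ⸨X⸩) =
            2 * HahnSeries.C α * HahnSeries.C (s.coeff 1 / (2 * α)) := by
          conv_lhs => rw [e1]
          rw [map_mul, map_mul, map_ofNat]
        have e3 : tpow 1 * tpow 1 = tpow 2 := tpow_mul_tpow 1 1
        rw [e2, hadef, ← hα, map_pow, map_pow, ← e3]
        ring
      have h1 : s - (HahnSeries.C (s.coeff 0) + HahnSeries.C (s.coeff 1) * tpow 1) ∈
          laurentGE 2 := by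
        have h0 : s - (HahnSeries.C (s.coeff 0) + HahnSeries.C (s.coeff 1) * tpow 1) ∈
            laurentGE 0 :=
          sub_mem hs.1 (add_mem (C_mem _) (mul_mem_laurentGE (C_mem _) (tpow_mem 1) (by lia)))
        refine mem_laurentGE_succ (k := 1) (mem_laurentGE_succ (k := 0) h0 ?_) ?_
        · rw [HahnSeries.coeff_sub, HahnSeries.coeff_add, coeff_C_mul, coeff_tpow]
          simp
        · rw [HahnSeries.coeff_sub, HahnSeries.coeff_add, coeff_C_mul, coeff_tpow,
            HahnSeries.C_apply, HahnSeries.coeff_single_of_ne one_ne_zero]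
          simp
      rw [e, ← sub_sub]
      exact sub_mem h1 (mul_mem_laurentGE (C_mem _) (tpow_mem 2) (by lia))
    refine ⟨_, mul_mem (I4_le_I3 (translation_mem hmem)) (dilation_mem_I3 ha), ?_⟩
    rw [mul_smul, dilation_smul_ball ha, translation_smul_ball]
    congr 1
    ring
  · intro h hh
    exact ⟨_, I3_mobius_hasOrder hh le_rfl (by lia) hasOrder_one,
      (I3_smul_ball hh hN one_mem_laurentGE).symm⟩

/-- A ball of exponent 1 only remembers s₀, which constant dilations adjust freely; this is why
O_0^open does not split. -/
theorem isCommonOrbit_hasOrder_zero_one : IsCommonOrbit (ballsAt 1 {s | HasOrder 0 s}) := by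
  refine isCommonOrbit_of_forall (ball 1 1) ?_ ?_ rotFlag_mem_ballsAt_hasOrder
  · rintro _ ⟨s, hs, rfl⟩
    obtain ⟨g, hg, e⟩ := exists_I4_smul_ball (N := 1) (s := 1)
      (s' := HahnSeries.C (s.coeff 0) * 1) hs.2 (by rw [sub_self]; exact zero_mem _)
    refine ⟨g, hg, e.trans ((ball_eq_ball_iff _ _ _).mpr ?_)⟩
    refine mem_laurentGE_succ (k := 0) (sub_mem (by simpa using C_mem _) hs.1) ?_
    rw [mul_one, HahnSeries.coeff_sub, HahnSeries.C_apply, HahnSeries.coeff_single_same, sub_self]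
  · intro h hh
    exact ⟨_, I3_mobius_hasOrder hh le_rfl (by lia) hasOrder_one,
      (I3_smul_ball hh (by lia) one_mem_laurentGE).symm⟩

/-- The set of units of `ℂ[[t]]` with vanishing linear term. -/
def unitsHyp : Set ℂ⸨X⸩ := {s | HasOrder 0 s ∧ s.coeff 1 = 0}

/-- The set of units of `ℂ[[t]]` with nonvanishing linear term. -/
def unitsOpen : Set ℂ⸨X⸩ := {s | HasOrder 0 s ∧ s.coeff 1 ≠ 0}

theorem sub_C_mul_mem_two {s s' : ℂ⸨X⸩} {r : ℂ} (hs : s ∈ laurentGE 0) (hs' : s' ∈ laurentGE 0)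
    (h0 : s'.coeff 0 = r * s.coeff 0) (h1 : s'.coeff 1 = r * s.coeff 1) :
    s' - HahnSeries.C r * s ∈ laurentGE 2 := by
  refine mem_laurentGE_succ (k := 1) (mem_laurentGE_succ (k := 0)
    (sub_mem hs' (mul_mem_laurentGE (C_mem _) hs (by lia))) ?_) ?_
  · rw [HahnSeries.coeff_sub, coeff_C_mul, h0, sub_self]
  · rw [HahnSeries.coeff_sub, coeff_C_mul, h1, sub_self]

theorem I4_mobius_coeff_one {h : LoopSL2} (hh : h ∈ I4) {s : ℂ⸨X⸩} (hs : s ∈ laurentGE 0) :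
    ((h 0 0 * s + h 0 1) / (h 1 0 * s + h 1 1)).coeff 1 = 0 ↔ s.coeff 1 = 0 := by
  obtain ⟨r, hr, h'⟩ := I4_mobius hh
  have e := h' s hs 1 (by lia)
  rw [HahnSeries.coeff_sub, coeff_C_mul, sub_eq_zero] at e
  rw [e, mul_eq_zero, or_iff_right hr]

theorem isOrbit_I4_unitsHyp {N : ℤ} (hN : 0 ≤ N) : IsOrbit I4 (ballsAt N unitsHyp) := by
  have h1 : (1 : ℂ⸨X⸩).coeff 1 = 0 := by rw [HahnSeries.coeff_one, if_neg one_ne_zero]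
  refine isOrbit_of_forall (ball N 1) ?_ ?_
  · rintro _ ⟨s, hs, rfl⟩
    refine exists_I4_smul_ball hs.1.2 (sub_C_mul_mem_two one_mem_laurentGE hs.1.1 ?_ ?_)
    · rw [HahnSeries.coeff_one, if_pos rfl, mul_one]
    · rw [h1, mul_zero, hs.2]
  · intro h hh
    have hh3 := I4_le_I3 hh
    exact ⟨_, ⟨I3_mobius_hasOrder hh3 le_rfl (by lia) hasOrder_one,
      (I4_mobius_coeff_one hh one_mem_laurentGE).mpr h1⟩,
      (I3_smul_ball hh3 hN one_mem_laurentGE).symm⟩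

theorem isOrbit_I4rot_unitsHyp {N : ℤ} (hN : 0 ≤ N) : IsOrbit I4rot (ballsAt N unitsHyp) :=
  (isOrbit_I4_unitsHyp hN).rot_of_invariant fun γ => rotFlag_mem_ballsAt
    (fun γ s (hs : s ∈ unitsHyp) => (⟨hs.1.rescaleT γ, coeff_rescaleT_eq_zero.mpr hs.2⟩ : _ ∈ unitsHyp)) γ

/-- Up to I₄ a unit center is determined by s₁ / s₀. Starting from 1 + t, rotation by γ = s₁ / s₀
produces any nonzero ratio. -/
theorem isOrbit_I4rot_unitsOpen {N : ℤ} (hN : 0 ≤ N) : IsOrbit I4rot (ballsAt N unitsOpen) := by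
  have hc0 : (1 + tpow 1).coeff 0 = 1 := by
    rw [HahnSeries.coeff_add, coeff_tpow]
    simp
  have hc1 : (1 + tpow 1).coeff 1 = 1 := by
    rw [HahnSeries.coeff_add, coeff_tpow, HahnSeries.coeff_one]
    simp
  have hu : HasOrder 0 (1 + tpow 1) := hasOrder_one.add_of_mem (tpow_mem 1)
  refine isOrbit_I4rot_of_forall (ball N (1 + tpow 1)) ?_ ?_
  · rintro _ ⟨s, hs, rfl⟩
    obtain ⟨g, hg, e⟩ := exists_I4_smul_ball (N := N) hs.1.2 (sub_C_mul_mem_two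
      (s := rescaleT (Units.mk0 (s.coeff 1 / s.coeff 0) (div_ne_zero hs.2 hs.1.2)) (1 + tpow 1))
      (hu.rescaleT _).1 hs.1.1 (by rw [rescaleT_coeff, hc0]; simp)
      (by
        rw [rescaleT_coeff, hc1]
        have := hs.1.2
        simp
        field_simp))
    exact ⟨g, hg, _, by rw [rotFlag_ball, e]⟩
  · intro h hh γ
    have hh3 := I4_le_I3 hh
    have hv := hu.rescaleT γ
    rw [rotFlag_ball, I3_smul_ball hh3 hN hv.1]
    refine ⟨_, ⟨I3_mobius_hasOrder hh3 le_rfl (by lia) hv, ?_⟩, rfl⟩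
    rw [Ne, I4_mobius_coeff_one hh hv.1, coeff_rescaleT_eq_zero, hc1]
    exact one_ne_zero

/-! ### Identification of the explicit sets of flags with sets of balls -/

/-- The part of a Laurent series consisting of the terms of degree less than `n`. -/
def truncBelow (n : ℤ) (x : ℂ⸨X⸩) : ℂ⸨X⸩ where
  coeff k := if k < n then x.coeff k else 0
  isPWO_support' := x.isPWO_support.mono fun k hk => by
    simp only [Function.mem_support] at hk
    rw [HahnSeries.mem_support]
    intro h
    simp [h] at hk

theorem coeff_truncBelow (n : ℤ) (x : ℂ⸨X⸩) (k : ℤ) :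
    (truncBelow n x).coeff k = if k < n then x.coeff k else 0 := rfl

theorem truncBelow_sub_mem (n : ℤ) (x : ℂ⸨X⸩) : truncBelow n x - x ∈ laurentGE n := fun j hj => by
  rw [HahnSeries.coeff_sub, coeff_truncBelow, if_pos hj, sub_self]

/-- The point [n, p] depends only on p modulo t^n, so truncation gives the normal form of p. The
conditions Q and R must therefore be decided by coefficients of p in degrees below n, which is what
`h` expresses. -/
theorem image_pt_eq_ballsAt {n l k : ℤ} (hk : k = l + n) {Q R : ℂ⸨X⸩ → Prop}
    (h : ∀ p s : ℂ⸨X⸩, (∀ j < n, p.coeff j = s.coeff (j + n)) → (Q p ↔ R s)) :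
    pt n '' {p | p ∈ laurentSpan l (n - 1) ∧ Q p} = ballsAt (2 * n) {s | s ∈ laurentGE k ∧ R s} := by
  subst hk
  refine Set.Subset.antisymm ?_ ?_
  · rintro _ ⟨p, ⟨hp, hQ⟩, rfl⟩
    refine ⟨tpow n * p, ⟨fun j hj => ?_, (h _ _ fun j _ => ?_).mp hQ⟩, (pt_eq_ball n p).symm⟩
    · rw [coeff_tpow_mul]
      by_contra h0
      have := hp _ h0
      lia
    · rw [coeff_tpow_mul, add_sub_cancel_right]
  · rintro _ ⟨s, ⟨hs, hR⟩, rfl⟩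
    refine ⟨truncBelow n (tpow (-n) * s), ⟨fun j hj => ?_, (h _ s fun j hj => ?_).mpr hR⟩, ?_⟩
    · rw [coeff_truncBelow, coeff_tpow_mul] at hj
      split_ifs at hj with hjn
      · refine ⟨?_, by lia⟩
        by_contra! hlt
        exact hj (hs _ (by lia))
      · exact absurd rfl hj
    · rw [coeff_truncBelow, coeff_tpow_mul, if_pos hj, sub_neg_eq_add]
    · rw [pt_eq_ball, ball_eq_ball_iff]
      have e : tpow n * truncBelow n (tpow (-n) * s) - s =
          tpow n * (truncBelow n (tpow (-n) * s) - tpow (-n) * s) := by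
        linear_combination s * tpow_mul_tpow_neg n
      rw [e, two_mul]
      exact tpow_mul_mem (truncBelow_sub_mem _ _)

theorem image_ptPrime_eq_ballsAt {n l k : ℤ} (hk : k = l + n) {Q R : ℂ⸨X⸩ → Prop}
    (h : ∀ p s : ℂ⸨X⸩, (∀ j ≤ n, p.coeff j = -s.coeff (j + n)) → (Q p ↔ R s)) :
    ptPrime n '' {p | p ∈ laurentSpan l n ∧ Q p} =
      ballsAt (2 * n + 1) {s | s ∈ laurentGE k ∧ R s} := by
  subst hk
  refine Set.Subset.antisymm ?_ ?_
  · rintro _ ⟨p, ⟨hp, hQ⟩, rfl⟩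
    refine ⟨-(tpow n * p), ⟨fun j hj => ?_, (h _ _ fun j _ => ?_).mp hQ⟩,
      (ptPrime_eq_ball n p).symm⟩
    · rw [HahnSeries.coeff_neg, coeff_tpow_mul, neg_eq_zero]
      by_contra h0
      have := hp _ h0
      lia
    · rw [HahnSeries.coeff_neg, neg_neg, coeff_tpow_mul, add_sub_cancel_right]
  · rintro _ ⟨s, ⟨hs, hR⟩, rfl⟩
    -- The exponent is 2n + 1 = n + (n + 1), so here degree n is still visible.
    refine ⟨truncBelow (n + 1) (-(tpow (-n) * s)), ⟨fun j hj => ?_, (h _ s fun j hj => ?_).mpr hR⟩,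
      ?_⟩
    · rw [coeff_truncBelow, HahnSeries.coeff_neg, coeff_tpow_mul] at hj
      split_ifs at hj with hjn
      · refine ⟨?_, by lia⟩
        by_contra! hlt
        exact hj (neg_eq_zero.mpr (hs _ (by lia)))
      · exact absurd rfl hj
    · rw [coeff_truncBelow, HahnSeries.coeff_neg, coeff_tpow_mul, if_pos (by lia), sub_neg_eq_add]
    · rw [ptPrime_eq_ball, ball_eq_ball_iff]
      have e : -(tpow n * truncBelow (n + 1) (-(tpow (-n) * s))) - s =
          -(tpow n * (truncBelow (n + 1) (-(tpow (-n) * s)) - -(tpow (-n) * s))) := by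
        linear_combination s * tpow_mul_tpow_neg n
      rw [e, show 2 * n + 1 = n + (n + 1) by ring]
      exact neg_mem (tpow_mul_mem (truncBelow_sub_mem _ _))

theorem image_pt_coeff_ne_zero {n l k : ℤ} (hk : k = l + n) (hl : l < n) :
    pt n '' {p | p ∈ laurentSpan l (n - 1) ∧ p.coeff l ≠ 0} =
      ballsAt (2 * n) {s | HasOrder k s} :=
  image_pt_eq_ballsAt hk fun p s h => by rw [h l hl, hk]

theorem image_ptPrime_coeff_ne_zero {n l k : ℤ} (hk : k = l + n) (hl : l ≤ n) :
    ptPrime n '' {p | p ∈ laurentSpan l n ∧ p.coeff l ≠ 0} =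
      ballsAt (2 * n + 1) {s | HasOrder k s} :=
  image_ptPrime_eq_ballsAt hk fun p s h => by rw [h l hl, hk, neg_ne_zero]

theorem image_pt_laurentSpan {n l k : ℤ} (hk : k = l + n) :
    pt n '' laurentSpan l (n - 1) = ballsAt (2 * n) (laurentGE k) := by
  have := image_pt_eq_ballsAt (Q := fun _ => True) (R := fun _ => True) hk fun _ _ _ => Iff.rfl
  simpa using this

theorem image_ptPrime_laurentSpan {n l k : ℤ} (hk : k = l + n) :
    ptPrime n '' laurentSpan l n = ballsAt (2 * n + 1) (laurentGE k) := by
  have := image_ptPrime_eq_ballsAt (Q := fun _ => True) (R := fun _ => True) hk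
    fun _ _ _ => Iff.rfl
  simpa using this

/-! ### Weyl translates of families of balls -/

theorem weylImage_hasOrder {N k : ℤ} (hk : k < N) :
    weylImage (ballsAt N {s | HasOrder k s}) = ballsAt (N - 2 * k) {s | HasOrder (-k) s} := by
  refine Set.Subset.antisymm ?_ ?_
  · rintro _ ⟨_, ⟨s, hs, rfl⟩, rfl⟩
    exact ⟨-s⁻¹, hs.inv.neg, (weyl_smul_ball hs hk).symm⟩
  · rintro _ ⟨s, hs, rfl⟩
    have hs' : HasOrder k (-s⁻¹) := by simpa using (HasOrder.inv hs).neg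
    refine ⟨_, ⟨-s⁻¹, hs', rfl⟩, ?_⟩
    change weyl • ball N (-s⁻¹) = _
    have e : -(-s⁻¹)⁻¹ = s := by
      ring_nf
      exact inv_inv s
    rw [weyl_smul_ball hs' hk, e]

/-- Inversion shifts the exponent by an amount depending on the order of the center, so it has to be
applied one order at a time. Centers of order at least N all give the ball around 0. -/
theorem ballsAt_laurentGE (N k : ℤ) : ballsAt N (laurentGE k) =
    (⋃ j ∈ Set.Icc k (N - 1), ballsAt N {s | HasOrder j s}) ∪ {ball N 0} := by
  refine Set.Subset.antisymm ?_ (Set.union_subset (Set.iUnion₂_subset ?_) ?_)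
  · rintro _ ⟨s, hs, rfl⟩
    rcases hasOrder_or_mem N s with h | ⟨j, hj, h⟩
    · exact Or.inr ((ball_eq_ball_iff _ _ _).mpr (by rwa [sub_zero]))
    · exact Or.inl (Set.mem_biUnion (show j ∈ Set.Icc k (N - 1) from ⟨h.le_of_mem hs, by lia⟩)
        ⟨s, h, rfl⟩)
  · rintro j ⟨hj, -⟩ _ ⟨s, hs, rfl⟩
    exact ⟨s, laurentGE_mono hj hs.1, rfl⟩
  · rintro _ rfl
    exact ⟨0, zero_mem _, rfl⟩

theorem ballsAt_laurentGE_of_le {N k : ℤ} (h : N ≤ k) : ballsAt N (laurentGE k) = {ball N 0} := by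
  rw [ballsAt_laurentGE, Set.Icc_eq_empty (by lia)]
  simp

theorem weylImage_laurentGE (N k : ℤ) : weylImage (ballsAt N (laurentGE k)) =
    (⋃ j ∈ Set.Icc k (N - 1), ballsAt (N - 2 * j) {s | HasOrder (-j) s}) ∪ {ball (1 - N) 0} := by
  rw [ballsAt_laurentGE, weylImage, Set.image_union, Set.image_iUnion₂, Set.image_singleton,
    weyl_smul_ball_zero]
  congr 1
  exact Set.iUnion₂_congr fun j hj => weylImage_hasOrder (by have := hj.2; lia)

/-- Matches the index m in E_n^hyp and O_n^hyp with the order j = -n - m of the center before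
inversion. -/
theorem biUnion_Icc_reflect {α : Type*} {a b a' b' c : ℤ} (ha : a' = c - b) (hb : b' = c - a)
    {f g : ℤ → Set α} (h : ∀ j ∈ Set.Icc a b, f j = g (c - j)) :
    ⋃ j ∈ Set.Icc a b, f j = ⋃ j ∈ Set.Icc a' b', g j := by
  subst ha hb
  simp only [Set.mem_Icc] at h ⊢
  refine Set.Subset.antisymm (Set.iUnion₂_subset fun j hj => ?_) (Set.iUnion₂_subset fun j hj => ?_)
  · rw [h j hj]
    exact Set.subset_biUnion_of_mem (u := g) (s := Set.Icc (c - b) (c - a)) ⟨by lia, by lia⟩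
  · have hj' : a ≤ c - j ∧ c - j ≤ b := ⟨by lia, by lia⟩
    have e := h _ hj'
    rw [sub_sub_cancel] at e
    rw [← e]
    exact Set.subset_biUnion_of_mem (u := f) (s := Set.Icc a b) hj'

/-! ### Dictionary between the named sets and families of balls -/

theorem singleton_pt_zero : ({pt 0 0} : Set Flag) = ballsAt 0 (laurentGE 2) := by
  rw [ballsAt_laurentGE_of_le (by lia), pt_eq_ball, mul_zero, mul_zero]

theorem Eopen_of_pos {n : ℤ} (hn : 0 < n) : Eopen n = ballsAt (2 * n) {s | HasOrder 0 s} := by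
  rw [Eopen, if_pos hn]
  exact image_pt_coeff_ne_zero (by lia) (by lia)

theorem Eopen_of_neg {n : ℤ} (hn : n < 0) :
    Eopen n = weylImage (ballsAt (1 - 2 * n) {s | HasOrder 1 s}) := by
  rw [Eopen, if_neg (by lia), weylImage_hasOrder (by lia),
    image_ptPrime_coeff_ne_zero (k := -1) (by lia) (by lia)]
  congr 1
  ring

theorem Oopen_of_nonneg {n : ℤ} (hn : 0 ≤ n) :
    Oopen n = ballsAt (2 * n + 1) {s | HasOrder 0 s} := by
  rw [Oopen, if_pos hn]
  exact image_ptPrime_coeff_ne_zero (by lia) (by lia)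

theorem Oopen_of_neg {n : ℤ} (hn : n < 0) :
    Oopen n = weylImage (ballsAt (-2 * n) {s | HasOrder 1 s}) := by
  rw [Oopen, if_neg (by lia), weylImage_hasOrder (by lia), show -n - 2 = (-n - 1) - 1 by ring,
    image_pt_coeff_ne_zero (k := -1) (by lia) (by lia)]
  congr 1
  ring

theorem Ehyp_eq (n : ℤ) : Ehyp n = weylImage (ballsAt (1 - 2 * n) (laurentGE 2)) := by
  rw [Ehyp, weylImage_laurentGE, pt_eq_ball, mul_zero, sub_sub_cancel]
  congr 1
  refine biUnion_Icc_reflect (c := -n) (by ring) (by ring) fun j hj => ?_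
  rw [image_ptPrime_coeff_ne_zero (k := -(-n - j)) (by ring) hj.1]
  congr 1
  ring

theorem Ohyp_eq (n : ℤ) : Ohyp n = weylImage (ballsAt (-2 * n) (laurentGE 2)) := by
  rw [Ohyp, weylImage_laurentGE, ptPrime_eq_ball, mul_zero, neg_zero,
    show 1 - -2 * n = 2 * n + 1 by ring]
  congr 1
  refine biUnion_Icc_reflect (c := -n) (by ring) (by ring) fun j hj => ?_
  rw [image_pt_coeff_ne_zero (k := -(-n - j)) (by ring) hj.1]
  congr 1
  ring

theorem EhypOpen_eq {n : ℤ} (hn : 0 < n) : EhypOpen n = ballsAt (2 * n) {s | HasOrder 1 s} :=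
  image_pt_coeff_ne_zero (by ring) (by lia)

theorem EhypHyp_eq (n : ℤ) : EhypHyp n = ballsAt (2 * n) (laurentGE 2) :=
  image_pt_laurentSpan (by ring)

theorem OhypOpen_eq {n : ℤ} (hn : 0 < n) :
    OhypOpen n = ballsAt (2 * n + 1) {s | HasOrder 1 s} :=
  image_ptPrime_coeff_ne_zero (by ring) (by lia)

theorem OhypHyp_eq (n : ℤ) : OhypHyp n = ballsAt (2 * n + 1) (laurentGE 2) :=
  image_ptPrime_laurentSpan (by ring)

theorem EopenOpen_eq {n : ℤ} (hn : 0 < n) : EopenOpen n = ballsAt (2 * n) unitsOpen := by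
  refine (image_pt_eq_ballsAt (k := 0) (by ring) (R := fun s => s.coeff 0 ≠ 0 ∧ s.coeff 1 ≠ 0)
    fun p s h => ?_).trans ?_
  · rw [h (-n) (by lia), h (-n + 1) (by lia)]
    ring_nf
  · simp only [unitsOpen, HasOrder, and_assoc]

theorem EopenHyp_eq {n : ℤ} (hn : 0 < n) : EopenHyp n = ballsAt (2 * n) unitsHyp := by
  refine (image_pt_eq_ballsAt (k := 0) (by ring) (R := fun s => s.coeff 0 ≠ 0 ∧ s.coeff 1 = 0)
    fun p s h => ?_).trans ?_
  · rw [h (-n) (by lia), h (-n + 1) (by lia)]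
    ring_nf
  · simp only [unitsHyp, HasOrder, and_assoc]

theorem OopenOpen_eq {n : ℤ} (hn : 0 < n) : OopenOpen n = ballsAt (2 * n + 1) unitsOpen := by
  refine (image_ptPrime_eq_ballsAt (k := 0) (by ring)
    (R := fun s => s.coeff 0 ≠ 0 ∧ s.coeff 1 ≠ 0) fun p s h => ?_).trans ?_
  · rw [h (-n) (by lia), h (-n + 1) (by lia), neg_ne_zero, neg_ne_zero]
    ring_nf
  · simp only [unitsOpen, HasOrder, and_assoc]

theorem OopenHyp_eq {n : ℤ} (hn : 0 < n) : OopenHyp n = ballsAt (2 * n + 1) unitsHyp := by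
  refine (image_ptPrime_eq_ballsAt (k := 0) (by ring)
    (R := fun s => s.coeff 0 ≠ 0 ∧ s.coeff 1 = 0) fun p s h => ?_).trans ?_
  · rw [h (-n) (by lia), h (-n + 1) (by lia), neg_ne_zero, neg_eq_zero]
    ring_nf
  · simp only [unitsHyp, HasOrder, and_assoc]

theorem ballsAt_hasOrder_zero_eq_union (N : ℤ) :
    ballsAt N {s | HasOrder 0 s} = ballsAt N unitsOpen ∪ ballsAt N unitsHyp := by
  rw [ballsAt, ballsAt, ballsAt, ← Set.image_union]
  congr 1
  ext s
  simp only [unitsOpen, unitsHyp, Set.mem_union, Set.mem_ofPred_eq]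
  tauto

/-- For N ≥ 2 the linear coefficient of the center is determined by the ball. -/
theorem disjoint_unitsOpen_unitsHyp {N : ℤ} (hN : 2 ≤ N) :
    Disjoint (ballsAt N unitsOpen) (ballsAt N unitsHyp) := by
  rw [Set.disjoint_left]
  rintro _ ⟨s, hs, rfl⟩ ⟨s', hs', e⟩
  have h := (ball_eq_ball_iff _ _ _).mp e 1 (by lia)
  rw [HahnSeries.coeff_sub, hs'.2, zero_sub, neg_eq_zero] at h
  exact hs.2 h

/-! ### The list of the `I₃`-orbits -/

/-- `X` is one of the sets in the list of `I₃`-orbits. -/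
def IsListed (X : Set Flag) : Prop :=
  X = {pt 0 0} ∨ (∃ n : ℤ, n ≠ 0 ∧ X = Eopen n) ∨ (∃ n : ℤ, n < 0 ∧ X = Ehyp n) ∨
    (∃ n : ℤ, X = Oopen n) ∨ (∃ n : ℤ, n ≤ 0 ∧ X = Ohyp n) ∨
    (∃ n : ℤ, 0 < n ∧ X = EhypOpen n) ∨ (∃ n : ℤ, 0 < n ∧ X = EhypHyp n) ∨
    (∃ n : ℤ, 0 < n ∧ X = OhypOpen n) ∨ (∃ n : ℤ, 0 < n ∧ X = OhypHyp n)

theorem isListed_laurentGE_two {N : ℤ} (hN : 0 ≤ N) : IsListed (ballsAt N (laurentGE 2)) := by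
  obtain ⟨n, rfl | rfl⟩ := Int.even_or_odd' N
  · rcases (show 0 ≤ n by lia).eq_or_lt with rfl | hn
    · exact Or.inl singleton_pt_zero.symm
    · exact Or.inr (Or.inr (Or.inr (Or.inr (Or.inr (Or.inr (Or.inl ⟨n, hn, (EhypHyp_eq n).symm⟩))))))
  · rcases (show 0 ≤ n by lia).eq_or_lt with rfl | hn
    · refine Or.inr (Or.inr (Or.inr (Or.inr (Or.inl ⟨0, le_rfl, ?_⟩))))
      -- Exponent 1 is listed as O_0^hyp, which is the translate by `weyl` of the ball of exponent 0
      -- around 0.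
      rw [Ohyp_eq, ballsAt_laurentGE_of_le (by lia), ballsAt_laurentGE_of_le (by lia), weylImage,
        Set.image_singleton, weyl_smul_ball_zero]
      norm_num
    · exact Or.inr (Or.inr (Or.inr (Or.inr (Or.inr (Or.inr (Or.inr (Or.inr
        ⟨n, hn, (OhypHyp_eq n).symm⟩)))))))

theorem isListed_hasOrder_one {N : ℤ} (hN : 2 ≤ N) : IsListed (ballsAt N {s | HasOrder 1 s}) := by
  obtain ⟨n, rfl | rfl⟩ := Int.even_or_odd' N
  · have hn : 0 < n := by lia
    exact Or.inr (Or.inr (Or.inr (Or.inr (Or.inr (Or.inl ⟨n, hn, (EhypOpen_eq hn).symm⟩)))))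
  · have hn : 0 < n := by lia
    exact Or.inr (Or.inr (Or.inr (Or.inr (Or.inr (Or.inr (Or.inr (Or.inl
      ⟨n, hn, (OhypOpen_eq hn).symm⟩)))))))

theorem isListed_hasOrder_zero {N : ℤ} (hN : 1 ≤ N) : IsListed (ballsAt N {s | HasOrder 0 s}) := by
  obtain ⟨n, rfl | rfl⟩ := Int.even_or_odd' N
  · exact Or.inr (Or.inl ⟨n, by lia, (Eopen_of_pos (by lia)).symm⟩)
  · exact Or.inr (Or.inr (Or.inr (Or.inl ⟨n, (Oopen_of_nonneg (by lia)).symm⟩)))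

theorem isListed_weylImage_hasOrder_one {N : ℤ} (hN : 2 ≤ N) :
    IsListed (weylImage (ballsAt N {s | HasOrder 1 s})) := by
  obtain ⟨n, rfl | rfl⟩ := Int.even_or_odd' N
  · refine Or.inr (Or.inr (Or.inr (Or.inl ⟨-n, ?_⟩)))
    rw [Oopen_of_neg (by lia), neg_mul_neg]
  · refine Or.inr (Or.inl ⟨-n, by lia, ?_⟩)
    rw [Eopen_of_neg (by lia)]
    congr 2
    ring

theorem isListed_weylImage_laurentGE_two {N : ℤ} (hN : 2 ≤ N) :
    IsListed (weylImage (ballsAt N (laurentGE 2))) := by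
  obtain ⟨n, rfl | rfl⟩ := Int.even_or_odd' N
  · refine Or.inr (Or.inr (Or.inr (Or.inr (Or.inl ⟨-n, by lia, ?_⟩))))
    rw [Ohyp_eq, neg_mul_neg]
  · refine Or.inr (Or.inr (Or.inl ⟨-n, by lia, ?_⟩))
    rw [Ehyp_eq]
    congr 2
    ring

/-- Split by the order of the center: nonnegative orders are covered directly, negative ones after
inversion. A ball around 0 with N < 0 is the inverse of one with exponent 1 - N ≥ 2. -/
theorem exists_isListed_mem (q : Flag) : ∃ X, IsListed X ∧ q ∈ X := by
  obtain ⟨N, s, rfl⟩ := exists_eq_ball q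
  rcases hasOrder_or_mem N s with h | ⟨k, hk, hs⟩
  · have e : ball N s = ball N 0 := (ball_eq_ball_iff _ _ _).mpr (by rwa [sub_zero])
    rw [e]
    rcases le_or_gt 0 N with hN | hN
    · exact ⟨_, isListed_laurentGE_two hN, 0, zero_mem _, rfl⟩
    · refine ⟨_, isListed_weylImage_laurentGE_two (N := 1 - N) (by lia), _, ⟨0, zero_mem _, rfl⟩, ?_⟩
      change weyl • ball (1 - N) 0 = _
      rw [weyl_smul_ball_zero, sub_sub_cancel]
  · have hinv : ball N s ∈ weylImage (ballsAt (N - 2 * k) {s | HasOrder (-k) s}) := by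
      rw [weylImage_hasOrder (by lia)]
      exact ⟨s, by simpa using hs, by ring_nf⟩
    rcases (by lia : 2 ≤ k ∨ k = 1 ∨ k = 0 ∨ k = -1 ∨ k ≤ -2) with h | rfl | rfl | rfl | h
    · exact ⟨_, isListed_laurentGE_two (N := N) (by lia), s, laurentGE_mono h hs.1, rfl⟩
    · exact ⟨_, isListed_hasOrder_one (by lia), s, hs, rfl⟩
    · exact ⟨_, isListed_hasOrder_zero (by lia), s, hs, rfl⟩
    · exact ⟨_, isListed_weylImage_hasOrder_one (by lia), hinv⟩
    · refine ⟨_, isListed_weylImage_laurentGE_two (N := N - 2 * k) (by lia),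
        Set.image_mono (Set.image_mono ?_) hinv⟩
      exact fun s hs => laurentGE_mono (by lia) hs.1

/-! ### The named sets as orbits -/

theorem isCommonOrbit_weylImage_laurentGE_two {N : ℤ} (hN : 0 ≤ N) :
    IsCommonOrbit (weylImage (ballsAt N (laurentGE 2))) :=
  (isCommonOrbit_laurentGE_two hN).weylImage rotFlag_mem_ballsAt_laurentGE

theorem isCommonOrbit_weylImage_hasOrder_one {N : ℤ} (hN : 0 ≤ N) :
    IsCommonOrbit (weylImage (ballsAt N {s | HasOrder 1 s})) :=
  (isCommonOrbit_hasOrder_one hN).weylImage rotFlag_mem_ballsAt_hasOrder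

theorem isCommonOrbit_Eopen {n : ℤ} (hn : n < 0) : IsCommonOrbit (Eopen n) := by
  rw [Eopen_of_neg hn]
  exact isCommonOrbit_weylImage_hasOrder_one (by lia)

theorem isCommonOrbit_Ehyp {n : ℤ} (hn : n < 0) : IsCommonOrbit (Ehyp n) := by
  rw [Ehyp_eq]
  exact isCommonOrbit_weylImage_laurentGE_two (by lia)

theorem isCommonOrbit_Oopen {n : ℤ} (hn : n ≤ 0) : IsCommonOrbit (Oopen n) := by
  rcases hn.eq_or_lt with rfl | hn
  · rw [Oopen_of_nonneg le_rfl]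
    exact isCommonOrbit_hasOrder_zero_one
  · rw [Oopen_of_neg hn]
    exact isCommonOrbit_weylImage_hasOrder_one (by lia)

theorem isCommonOrbit_Ohyp {n : ℤ} (hn : n ≤ 0) : IsCommonOrbit (Ohyp n) := by
  rw [Ohyp_eq]
  exact isCommonOrbit_weylImage_laurentGE_two (by lia)

theorem isCommonOrbit_EhypOpen {n : ℤ} (hn : 0 < n) : IsCommonOrbit (EhypOpen n) := by
  rw [EhypOpen_eq hn]
  exact isCommonOrbit_hasOrder_one (by lia)

theorem isCommonOrbit_EhypHyp {n : ℤ} (hn : 0 < n) : IsCommonOrbit (EhypHyp n) := by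
  rw [EhypHyp_eq]
  exact isCommonOrbit_laurentGE_two (by lia)

theorem isCommonOrbit_OhypOpen {n : ℤ} (hn : 0 < n) : IsCommonOrbit (OhypOpen n) := by
  rw [OhypOpen_eq hn]
  exact isCommonOrbit_hasOrder_one (by lia)

theorem isCommonOrbit_OhypHyp {n : ℤ} (hn : 0 < n) : IsCommonOrbit (OhypHyp n) := by
  rw [OhypHyp_eq]
  exact isCommonOrbit_laurentGE_two (by lia)

theorem isCommonOrbit_pt_zero : IsCommonOrbit {pt 0 0} := by
  rw [singleton_pt_zero]
  exact isCommonOrbit_laurentGE_two le_rfl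

theorem IsListed.isOrbit {X : Set Flag} (hX : IsListed X) : IsOrbit I3 X := by
  rcases hX with rfl | ⟨n, hn, rfl⟩ | ⟨n, hn, rfl⟩ | ⟨n, rfl⟩ | ⟨n, hn, rfl⟩ | ⟨n, hn, rfl⟩ |
    ⟨n, hn, rfl⟩ | ⟨n, hn, rfl⟩ | ⟨n, hn, rfl⟩
  · exact isCommonOrbit_pt_zero.1
  · rcases hn.lt_or_gt with hn | hn
    · exact (isCommonOrbit_Eopen hn).1
    · rw [Eopen_of_pos hn]
      exact isOrbit_I3_hasOrder_zero (by lia)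
  · exact (isCommonOrbit_Ehyp hn).1
  · rcases le_or_gt n 0 with hn | hn
    · exact (isCommonOrbit_Oopen hn).1
    · rw [Oopen_of_nonneg hn.le]
      exact isOrbit_I3_hasOrder_zero (by lia)
  · exact (isCommonOrbit_Ohyp hn).1
  · exact (isCommonOrbit_EhypOpen hn).1
  · exact (isCommonOrbit_EhypHyp hn).1
  · exact (isCommonOrbit_OhypOpen hn).1
  · exact (isCommonOrbit_OhypHyp hn).1

/-- Orbits sharing a point are equal, so it suffices that the listed sets are orbits and cover the
flag variety. -/
theorem isOrbit_I3_iff_isListed (X : Set Flag) : IsOrbit I3 X ↔ IsListed X := by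
  refine ⟨?_, IsListed.isOrbit⟩
  rintro ⟨x, rfl⟩
  obtain ⟨Y, hY, hx⟩ := exists_isListed_mem x
  obtain ⟨y, hy⟩ := hY.isOrbit
  rw [hy] at hx
  rwa [MulAction.orbit_eq_iff.mpr hx, ← hy]

theorem Ohyp_zero : Ohyp 0 = {ptPrime 0 0} := by
  rw [Ohyp, Set.Icc_eq_empty (by lia)]
  simp

theorem Ohyp_neg_one : Ohyp (-1) = {ptPrime (-1) 0} := by
  rw [Ohyp, Set.Icc_eq_empty (by lia)]
  simp

theorem EhypHyp_one : EhypHyp 1 = {pt 1 0} := by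
  rw [EhypHyp_eq, ballsAt_laurentGE_of_le (by lia), pt_eq_ball, mul_zero]

theorem isCommonOrbit_points : ∀ X ∈ ({{pt 0 0}, {ptPrime 0 0}, {ptPrime (-1) 0}, {pt 1 0}} :
    Set (Set Flag)), IsCommonOrbit X := by
  rintro _ (rfl | rfl | rfl | rfl)
  · exact isCommonOrbit_pt_zero
  · exact Ohyp_zero ▸ isCommonOrbit_Ohyp le_rfl
  · exact Ohyp_neg_one ▸ isCommonOrbit_Ohyp (by lia)
  · exact EhypHyp_one ▸ isCommonOrbit_EhypHyp one_pos

/-! ### Globally defined fractions of polynomials in the coordinates -/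

section Fractions

variable {M M' ι κ : Type*} {c : M → ι → ℂ} {c' : M' → κ → ℂ}

/-- `F` is a quotient of two polynomials in the coordinates `c`, with denominator vanishing
nowhere. -/
def IsFraction (c : M → ι → ℂ) (F : M → ℂ) : Prop :=
  ∃ A B : MvPolynomial ι ℂ, ∀ x, MvPolynomial.eval (c x) B ≠ 0 ∧
    F x = MvPolynomial.eval (c x) A / MvPolynomial.eval (c x) B

namespace IsFraction

variable {F G : M → ℂ}

theorem coord (i : ι) : IsFraction c fun x => c x i :=
  ⟨MvPolynomial.X i, 1, fun x => by simp⟩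

theorem const (r : ℂ) : IsFraction c fun _ => r := ⟨MvPolynomial.C r, 1, fun x => by simp⟩

theorem add (hF : IsFraction c F) (hG : IsFraction c G) : IsFraction c fun x => F x + G x := by
  obtain ⟨A, B, h⟩ := hF
  obtain ⟨A', B', h'⟩ := hG
  refine ⟨A * B' + B * A', B * B', fun x => ⟨?_, ?_⟩⟩
  · rw [map_mul]
    exact mul_ne_zero (h x).1 (h' x).1
  · dsimp only
    rw [(h x).2, (h' x).2, map_add, map_mul, map_mul, map_mul, div_add_div _ _ (h x).1 (h' x).1]

theorem mul (hF : IsFraction c F) (hG : IsFraction c G) : IsFraction c fun x => F x * G x := by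
  obtain ⟨A, B, h⟩ := hF
  obtain ⟨A', B', h'⟩ := hG
  refine ⟨A * A', B * B', fun x => ⟨?_, ?_⟩⟩
  · rw [map_mul]
    exact mul_ne_zero (h x).1 (h' x).1
  · dsimp only
    rw [(h x).2, (h' x).2, map_mul, map_mul, div_mul_div_comm]

theorem neg (hF : IsFraction c F) : IsFraction c fun x => -F x := by
  simpa using (const (c := c) (-1)).mul hF

theorem inv (hF : IsFraction c F) (h0 : ∀ x, F x ≠ 0) : IsFraction c fun x => (F x)⁻¹ := by
  obtain ⟨A, B, h⟩ := hF
  refine ⟨B, A, fun x => ⟨fun hA => h0 x ?_, ?_⟩⟩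
  · rw [(h x).2, hA, zero_div]
  · dsimp only
    rw [(h x).2, inv_div]

theorem sum {J : Type*} (s : Finset J) {F : J → M → ℂ} (hF : ∀ j ∈ s, IsFraction c (F j)) :
    IsFraction c fun x => ∑ j ∈ s, F j x := by
  classical
  induction s using Finset.induction_on with
  | empty => simpa using const 0
  | insert a s ha ih =>
    simp only [Finset.sum_insert ha]
    exact (hF a (Finset.mem_insert_self a s)).add
      (ih fun j hj => hF j (Finset.mem_insert_of_mem hj))

theorem congr (hF : IsFraction c F) (h : ∀ x, G x = F x) : IsFraction c G := by
  rwa [funext h]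

theorem eval {r : M → κ → ℂ} (hr : ∀ i, IsFraction c fun x => r x i) (P : MvPolynomial κ ℂ) :
    IsFraction c fun x => MvPolynomial.eval (r x) P := by
  induction P using MvPolynomial.induction_on with
  | C a => simpa using const a
  | add p q hp hq => simpa using hp.add hq
  | mul_X p i hp => simpa using hp.mul (hr i)

end IsFraction

/-- A map all of whose coordinates are globally defined fractions. -/
def IsFractionMap (c : M → ι → ℂ) (c' : M' → κ → ℂ) (h : M → M') : Prop :=
  ∀ i, IsFraction c fun x => c' (h x) i

/-- The pullback of Q is a fraction A / B with B vanishing nowhere, so A cuts out the same open set.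
-/
theorem ZariskiOpen.preimage {h : M → M'} (hh : IsFractionMap c c' h) {U : Set M'}
    (hU : ZariskiOpen c' U) : ZariskiOpen c (h ⁻¹' U) := by
  intro x hx
  obtain ⟨Q, hQ, hQU⟩ := hU _ hx
  obtain ⟨A, B, hAB⟩ := IsFraction.eval hh Q
  dsimp only at hAB
  refine ⟨A, ?_, fun y hy => hQU _ ?_⟩
  · rw [(hAB x).2] at hQ
    exact (div_ne_zero_iff.mp hQ).1
  · rw [(hAB y).2]
    exact div_ne_zero hy (hAB y).1

theorem RegularOn.comp {h : M → M'} (hh : IsFractionMap c c' h) {U : Set M'} {f : M' → ℂ}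
    (hf : RegularOn c' U f) : RegularOn c (h ⁻¹' U) (f ∘ h) := by
  intro x hx
  obtain ⟨P, Q, hQ, hPQ⟩ := hf _ hx
  obtain ⟨A, B, hAB⟩ := IsFraction.eval hh P
  obtain ⟨A', B', hAB'⟩ := IsFraction.eval hh Q
  dsimp only at hAB hAB'
  refine ⟨A * B', B * A', ?_, fun y hy hy' => ?_⟩
  · rw [(hAB' x).2] at hQ
    rw [map_mul]
    exact mul_ne_zero (hAB x).1 (div_ne_zero_iff.mp hQ).1
  · rw [map_mul] at hy'
    have hQy : MvPolynomial.eval (c' (h y)) Q ≠ 0 := by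
      rw [(hAB' y).2]
      exact div_ne_zero (right_ne_zero_of_mul hy') (hAB' y).1
    rw [Function.comp_apply, hPQ _ hy hQy, (hAB y).2, (hAB' y).2, map_mul, map_mul,
      div_div_div_eq]

end Fractions

/-- Openness and regularity on E are defined on the preimage in the loop group. They pull back along
σ to the torus side and along φ⁻¹ ∘ `proj` to the loop side, so two fraction maps suffice. -/
theorem isoTorusAffine_of_section {E : Set Flag} {a b : ℕ}
    (φ : ((Fin a → ℂˣ) × (Fin b → ℂ)) ≃ E)
    (σ : (Fin a → ℂˣ) × (Fin b → ℂ) → {g : LoopSL2 // (g : Flag) ∈ E})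
    (hσφ : ∀ x, proj E (σ x) = φ x) (hσ : IsFractionMap (torusAffineCoord a b) (loopCoord E) σ)
    (hφ : IsFractionMap (loopCoord E) (torusAffineCoord a b) (φ.symm ∘ proj E)) :
    IsoTorusAffine E a b := by
  have e1 (V : Set E) : φ ⁻¹' V = σ ⁻¹' (proj E ⁻¹' V) := by
    ext x
    simp [hσφ]
  have e2 (V : Set E) : proj E ⁻¹' V = (φ.symm ∘ proj E) ⁻¹' (φ ⁻¹' V) := by
    ext x
    simp
  have e3 (f : E → ℂ) : f ∘ φ = (f ∘ proj E) ∘ σ := by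
    ext x
    simp [hσφ]
  have e4 (f : E → ℂ) : f ∘ proj E = (f ∘ φ) ∘ (φ.symm ∘ proj E) := by
    ext x
    simp
  refine ⟨φ, fun V => ⟨fun h => ?_, fun h => ?_⟩, fun V f _ => ⟨fun h => ?_, fun h => ?_⟩⟩
  · rw [e1]
    exact ZariskiOpen.preimage hσ h
  · rw [FlagOpen, e2]
    exact ZariskiOpen.preimage hφ h
  · rw [e1, e3]
    exact RegularOn.comp hσ h
  · rw [FlagRegularOn, e2, e4]
    exact RegularOn.comp hφ h

/-! ### Recovering the center of a ball from a matrix -/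

theorem column_of_mk_eq_ball {g : LoopSL2} {N : ℤ} (hN : 0 ≤ N) {s : ℂ⸨X⸩} (hs : s ∈ laurentGE 0)
    (h : (g : Flag) = ball N s) {j : Fin 2} (hj : j = if N % 2 = 0 then 1 else 0) :
    g 0 j ∈ laurentGE (-(N / 2)) ∧ HasOrder (-(N / 2)) (g 1 j) ∧
      g 0 j - s * g 1 j ∈ laurentGE (N - N / 2) := by
  obtain ⟨h1, h2, h3, h4⟩ := (mk_eq_ball_iff _ _ _).mp h
  have hdet : 1 = (g 0 0 - s * g 1 0) * g 1 1 - (g 0 1 - s * g 1 1) * g 1 0 := by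
    linear_combination -det_loop g
  -- If the selected lower entry had larger order, the determinant would lie in t ℂ[[t]].
  have hone : ¬ (1 : ℂ⸨X⸩) ∈ laurentGE 1 := fun h => by simpa using h 0 one_pos
  have key : HasOrder (-(N / 2)) (g 1 j) ∧ g 0 j - s * g 1 j ∈ laurentGE (N - N / 2) := by
    split_ifs at hj with hpar <;> subst hj
    · refine ⟨HasOrder.of_mem_not_mem h2 fun h' => hone ?_, laurentGE_mono (by lia) h4⟩
      rw [hdet]
      exact sub_mem (mul_mem_laurentGE h3 h' (by lia)) (mul_mem_laurentGE h4 h1 (by lia))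
    · refine ⟨HasOrder.of_mem_not_mem (laurentGE_mono (by lia) h1) fun h' => hone ?_,
        laurentGE_mono (by lia) h3⟩
      rw [hdet]
      exact sub_mem (mul_mem_laurentGE h3 h2 (by lia)) (mul_mem_laurentGE h4 h' (by lia))
  refine ⟨?_, key⟩
  simpa using add_mem (laurentGE_mono (by lia) key.2) (mul_mem_laurentGE hs key.1.1 (zero_add _).ge)

/-- The power series with coefficients `x_{-n}, x_{-n+1}, …`. -/
def shiftedSeries (n : ℤ) (x : ℂ⸨X⸩) : ℂ⟦X⟧ := PowerSeries.mk fun k => x.coeff (k - n)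

theorem incl_shiftedSeries {n : ℤ} {x : ℂ⸨X⸩} (hx : x ∈ laurentGE (-n)) :
    incl (shiftedSeries n x) = tpow n * x := by
  obtain ⟨f, hf⟩ := exists_incl (x := tpow n * x) (by simpa using tpow_mul_mem (k := n) hx)
  rw [hf]
  congr 1
  ext k
  rw [shiftedSeries, PowerSeries.coeff_mk, ← coeff_incl_natCast, ← hf, coeff_tpow_mul]

theorem constantCoeff_shiftedSeries {n : ℤ} {x : ℂ⸨X⸩} (hx : HasOrder (-n) x) :
    PowerSeries.constantCoeff (shiftedSeries n x) ≠ 0 := by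
  rw [← PowerSeries.coeff_zero_eq_constantCoeff_apply, shiftedSeries, PowerSeries.coeff_mk]
  simpa using hx.2

/-- The power series `y / d` for a column `(y, d)` of `g` in which both entries have order at
least `-n` and `d` has order exactly `-n`. -/
def columnSlope (n : ℤ) (j : Fin 2) (g : LoopSL2) : ℂ⟦X⟧ :=
  shiftedSeries n (g 0 j) * (shiftedSeries n (g 1 j))⁻¹

/-- The deviation of the column has order at least N - N / 2, and dividing by an entry of order -(N
/ 2) raises this to N. -/
theorem columnSlope_sub_mem {g : LoopSL2} {N : ℤ} (hN : 0 ≤ N) {s : ℂ⸨X⸩} (hs : s ∈ laurentGE 0)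
    (h : (g : Flag) = ball N s) {j : Fin 2} (hj : j = if N % 2 = 0 then 1 else 0) :
    incl (columnSlope (N / 2) j g) - s ∈ laurentGE N := by
  obtain ⟨h1, h2, h3⟩ := column_of_mk_eq_ball hN hs h hj
  have e : columnSlope (N / 2) j g * shiftedSeries (N / 2) (g 1 j) =
      shiftedSeries (N / 2) (g 0 j) := by
    rw [columnSlope, mul_assoc, PowerSeries.inv_mul_cancel _ (constantCoeff_shiftedSeries h2),
      mul_one]
  have e' := congrArg incl e
  rw [map_mul, incl_shiftedSeries h1, incl_shiftedSeries h2.1] at e'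
  have e'' : incl (columnSlope (N / 2) j g) * g 1 j = g 0 j := by
    linear_combination tpow (-(N / 2)) * e' +
      (g 0 j - incl (columnSlope (N / 2) j g) * g 1 j) * tpow_mul_tpow_neg (N / 2)
  have h4 : incl (columnSlope (N / 2) j g) - s = (g 0 j - s * g 1 j) * (g 1 j)⁻¹ := by
    rw [← e'', ← sub_mul, mul_assoc, mul_inv_cancel₀ h2.ne_zero, mul_one]
  rw [h4]
  exact mul_mem_laurentGE h3 h2.inv.1 (by lia)

/-- The recursion for the coefficients of an inverse power series divides only by the constant
coefficient. -/
theorem isFraction_coeff_inv {M ι : Type*} {c : M → ι → ℂ} {D : M → ℂ⟦X⟧}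
    (hD : ∀ k, IsFraction c fun x => PowerSeries.coeff k (D x))
    (h0 : ∀ x, PowerSeries.constantCoeff (D x) ≠ 0) (k : ℕ) :
    IsFraction c fun x => PowerSeries.coeff k (D x)⁻¹ := by
  have hinv : IsFraction c fun x => (PowerSeries.constantCoeff (D x))⁻¹ :=
    IsFraction.inv (by simpa using hD 0) h0
  induction k using Nat.strong_induction_on with
  | _ k ih =>
    by_cases hk : k = 0
    · exact hinv.congr fun x => (PowerSeries.coeff_inv k (D x)).trans (if_pos hk)
    · refine IsFraction.congr ?_ fun x => (PowerSeries.coeff_inv k (D x)).trans (if_neg hk)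
      refine hinv.neg.mul (IsFraction.sum _ fun p hp => ?_)
      split_ifs with hlt
      · exact (hD _).mul (ih _ hlt)
      · exact IsFraction.const 0

theorem isFraction_coeff_mul {M ι : Type*} {c : M → ι → ℂ} {F G : M → ℂ⟦X⟧}
    (hF : ∀ k, IsFraction c fun x => PowerSeries.coeff k (F x))
    (hG : ∀ k, IsFraction c fun x => PowerSeries.coeff k (G x)) (k : ℕ) :
    IsFraction c fun x => PowerSeries.coeff k (F x * G x) := by
  simp only [PowerSeries.coeff_mul]
  exact IsFraction.sum _ fun p _ => (hF _).mul (hG _)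

theorem isFraction_columnSlope {E : Set Flag} {n : ℤ} {j : Fin 2}
    (h : ∀ g : LoopSL2, (g : Flag) ∈ E → HasOrder (-n) (g 1 j)) (k : ℕ) :
    IsFraction (loopCoord E) fun g => PowerSeries.coeff k (columnSlope n j g.1) := by
  have hcoeff (i : Fin 2) (k : ℕ) : IsFraction (loopCoord E)
      fun g => PowerSeries.coeff k (shiftedSeries n (g.1 i j)) :=
    (IsFraction.coord (i, j, (k : ℤ) - n)).congr fun g => by
      rw [shiftedSeries, PowerSeries.coeff_mk]
      rfl
  exact isFraction_coeff_mul (hcoeff 0)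
    (isFraction_coeff_inv (hcoeff 1) fun g => constantCoeff_shiftedSeries (h g.1 g.2)) k

/-! ### Families of balls parametrized by coefficients of the center -/

section Parametrization

variable {a b N : ℕ} {idx : Fin a ⊕ Fin b → ℕ}

/-- The power series with coefficient `v i` in degree `idx i`. -/
def seriesOf (idx : Fin a ⊕ Fin b → ℕ) (v : Fin a ⊕ Fin b → ℂ) : ℂ⟦X⟧ :=
  PowerSeries.mk fun k => ∑ i, if idx i = k then v i else 0

theorem coeff_seriesOf (hidx : Function.Injective idx) (v : Fin a ⊕ Fin b → ℂ)
    (i : Fin a ⊕ Fin b) : PowerSeries.coeff (idx i) (seriesOf idx v) = v i := by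
  rw [seriesOf, PowerSeries.coeff_mk, Finset.sum_eq_single i]
  · rw [if_pos rfl]
  · intro j _ hj
    rw [if_neg (hidx.ne hj)]
  · simp

theorem coeff_seriesOf_eq_zero (v : Fin a ⊕ Fin b → ℂ) {k : ℕ} (hk : k ∉ Set.range idx) :
    PowerSeries.coeff k (seriesOf idx v) = 0 := by
  rw [seriesOf, PowerSeries.coeff_mk]
  refine Finset.sum_eq_zero fun i _ => if_neg fun h => hk ⟨i, h⟩

/-- The integral centers whose coefficients in degrees less than `N` are concentrated in the
degrees `idx i`, with nonzero coefficients for the first `a` indices. -/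
def centersOf (N : ℕ) (idx : Fin a ⊕ Fin b → ℕ) : Set ℂ⸨X⸩ :=
  {s | s ∈ laurentGE 0 ∧ (∀ i, s.coeff (idx (Sum.inl i)) ≠ 0) ∧
    ∀ k : ℕ, k < N → k ∉ Set.range idx → s.coeff k = 0}

theorem incl_seriesOf_mem (hidx : Function.Injective idx) (x : (Fin a → ℂˣ) × (Fin b → ℂ)) :
    incl (seriesOf idx (torusAffineCoord a b x)) ∈ centersOf N idx := by
  refine ⟨incl_mem _, fun i => ?_, fun k _ hk => ?_⟩
  · rw [coeff_incl_natCast, coeff_seriesOf hidx]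
    exact (x.1 i).ne_zero
  · rw [coeff_incl_natCast, coeff_seriesOf_eq_zero _ hk]

theorem isFraction_coeff_incl_seriesOf (k : ℤ) : IsFraction (torusAffineCoord a b)
    fun x => (incl (seriesOf idx (torusAffineCoord a b x))).coeff k := by
  simp only [PowerSeries.coeff_coe]
  split_ifs with hk
  · exact IsFraction.const 0
  · simp only [seriesOf, PowerSeries.coeff_mk]
    refine IsFraction.sum _ fun i _ => ?_
    split_ifs
    · exact IsFraction.coord i
    · exact IsFraction.const 0

theorem isFraction_coeff_ballRep {M ι : Type*} {c : M → ι → ℂ} {s : M → ℂ⸨X⸩}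
    (hs : ∀ k, IsFraction c fun x => (s x).coeff k) (N : ℤ) (i j : Fin 2) (k : ℤ) :
    IsFraction c fun x => (ballRep N (s x) i j).coeff k := by
  obtain ⟨n, rfl | rfl⟩ := Int.even_or_odd' N
  · simp only [ballRep_even, upperRep]
    fin_cases i <;> fin_cases j
    · exact IsFraction.const _
    · exact (hs (k - -n)).congr fun x => coeff_tpow_mul _ _ _
    · exact IsFraction.const _
    · exact IsFraction.const _
  · simp only [ballRep_odd, primeRep]
    fin_cases i <;> fin_cases j
    · exact (hs (k - -n)).neg.congr fun x => congrArg Neg.neg (coeff_tpow_mul (-n) k (s x))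
    · exact IsFraction.const _
    · exact IsFraction.const _
    · exact IsFraction.const _

/-- The parametrization of the balls with centers in `centersOf N idx`. -/
def ballParam (hidx : Function.Injective idx) (x : (Fin a → ℂˣ) × (Fin b → ℂ)) :
    ballsAt N (centersOf N idx) :=
  ⟨ball N (incl (seriesOf idx (torusAffineCoord a b x))), _, incl_seriesOf_mem hidx x, rfl⟩

theorem torusAffineCoord_injective : Function.Injective (torusAffineCoord a b) := by
  intro x y h
  refine Prod.ext (funext fun i => Units.ext ?_) (funext fun i => ?_)
  · exact congrFun h (Sum.inl i)
  · exact congrFun h (Sum.inr i)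

/-- Degrees below N can be read off the ball, which gives injectivity. Coefficients in degrees at
least N do not affect it, and those below N outside the range of `idx` vanish, which gives
surjectivity. -/
theorem ballParam_bijective (hidx : Function.Injective idx) (hN : ∀ i, idx i < N) :
    Function.Bijective (ballParam (N := N) hidx) := by
  constructor
  · intro x y h
    refine torusAffineCoord_injective (funext fun i => ?_)
    have h' := (ball_eq_ball_iff _ _ _).mp (congrArg Subtype.val h) (idx i) (by exact_mod_cast hN i)
    rwa [HahnSeries.coeff_sub, coeff_incl_natCast, coeff_incl_natCast, coeff_seriesOf hidx,
      coeff_seriesOf hidx, sub_eq_zero] at h'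
  · rintro ⟨_, s, ⟨hs0, hs1, hs2⟩, rfl⟩
    refine ⟨(fun i => Units.mk0 _ (hs1 i), fun i => s.coeff (idx (Sum.inr i))), Subtype.ext ?_⟩
    refine (ball_eq_ball_iff _ _ _).mpr fun k hk => ?_
    rw [HahnSeries.coeff_sub, sub_eq_zero]
    rcases lt_or_ge k 0 with hneg | hpos
    · rw [incl_mem _ k hneg, hs0 k hneg]
    · lift k to ℕ using hpos
      rw [coeff_incl_natCast]
      by_cases hr : k ∈ Set.range idx
      · obtain ⟨i, rfl⟩ := hr
        rw [coeff_seriesOf hidx]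
        cases i <;> rfl
      · rw [coeff_seriesOf_eq_zero _ hr, hs2 k (by exact_mod_cast hk) hr]

theorem isoTorusAffine_centersOf (hidx : Function.Injective idx) (hN : ∀ i, idx i < N) :
    IsoTorusAffine (ballsAt N (centersOf N idx)) a b := by
  refine isoTorusAffine_of_section (Equiv.ofBijective _ (ballParam_bijective hidx hN))
    (fun x => ⟨ballRep N (incl (seriesOf idx (torusAffineCoord a b x))), (ballParam hidx x).2⟩)
    (fun x => rfl) ?_ ?_
  · rintro ⟨i, j, k⟩
    exact isFraction_coeff_ballRep isFraction_coeff_incl_seriesOf N i j k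
  · intro i
    -- The inverse reads the coordinate i as the coefficient of the column ratio in degree `idx i` <
    -- N, where it agrees with the center.
    refine (isFraction_columnSlope (n := (N : ℤ) / 2) (j := if (N : ℤ) % 2 = 0 then 1 else 0)
      ?_ (idx i)).congr fun g => ?_
    · rintro g ⟨s, hs, e⟩
      exact (column_of_mk_eq_ball (by lia) hs.1 e.symm rfl).2.1
    · set x := ((Equiv.ofBijective _ (ballParam_bijective hidx hN)).symm ∘
        proj (ballsAt N (centersOf N idx))) g with hx
      have e : ballParam hidx x = proj (ballsAt N (centersOf N idx)) g :=
        (Equiv.ofBijective _ (ballParam_bijective hidx hN)).apply_symm_apply _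
      have e' : (g.1 : Flag) = ball N (incl (seriesOf idx (torusAffineCoord a b x))) :=
        (congrArg Subtype.val e).symm
      have h := columnSlope_sub_mem (by lia) (incl_mem _) e' rfl (idx i) (by exact_mod_cast hN i)
      rw [HahnSeries.coeff_sub, coeff_incl_natCast, coeff_incl_natCast, coeff_seriesOf hidx,
        sub_eq_zero] at h
      exact h.symm

end Parametrization

/-- The degrees `0, …, a - 1` and `2, …, b + 1`. -/
def degreesSkip (a b : ℕ) : Fin a ⊕ Fin b → ℕ := Sum.elim (fun i => i) fun j => j + 2

theorem degreesSkip_injective {a b : ℕ} (ha : a ≤ 2) : Function.Injective (degreesSkip a b) := by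
  rintro (i | i) (j | j) h <;> simp only [degreesSkip, Sum.elim_inl, Sum.elim_inr] at h
  · exact congrArg _ (Fin.ext h)
  · lia
  · lia
  · exact congrArg _ (Fin.ext (by lia))

theorem degreesSkip_lt {a b : ℕ} (ha : a ≤ 2) (i : Fin a ⊕ Fin b) : degreesSkip a b i < b + 2 := by
  rcases i with i | i <;> simp only [degreesSkip, Sum.elim_inl, Sum.elim_inr] <;> lia

theorem mem_range_degreesSkip {a b k : ℕ} (hk : k < b + 2) :
    k ∈ Set.range (degreesSkip a b) ↔ k < a ∨ 2 ≤ k := by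
  constructor
  · rintro ⟨i | i, rfl⟩ <;> simp only [degreesSkip, Sum.elim_inl, Sum.elim_inr] <;> lia
  · rintro (h | h)
    · exact ⟨Sum.inl ⟨k, h⟩, rfl⟩
    · exact ⟨Sum.inr ⟨k - 2, by lia⟩, Nat.sub_add_cancel h⟩

theorem unitsOpen_eq (b : ℕ) : unitsOpen = centersOf (b + 2) (degreesSkip 2 b) := by
  ext s
  simp only [unitsOpen, centersOf, HasOrder, Set.mem_ofPred_eq, Fin.forall_fin_two, and_assoc]
  refine and_congr_right fun _ => and_congr_right fun _ =>
    ⟨fun h => ⟨h, fun k hk hk' => ?_⟩, And.left⟩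
  rw [mem_range_degreesSkip hk] at hk'
  lia

theorem unitsHyp_eq (b : ℕ) : unitsHyp = centersOf (b + 2) (degreesSkip 1 b) := by
  ext s
  simp only [unitsHyp, centersOf, HasOrder, Set.mem_ofPred_eq, Fin.forall_fin_one, and_assoc]
  refine and_congr_right fun _ => and_congr_right fun _ => ⟨fun h k hk hk' => ?_, fun h => ?_⟩
  · rw [mem_range_degreesSkip hk] at hk'
    -- Degree 1 is the only one below b + 2 that is skipped.
    obtain rfl : k = 1 := by lia
    exact h
  · refine h 1 (by lia) ?_
    rw [mem_range_degreesSkip (by lia)]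
    lia

theorem isoTorusAffine_unitsOpen {N : ℤ} (hN : 2 ≤ N) :
    IsoTorusAffine (ballsAt N unitsOpen) 2 (N - 2).toNat := by
  obtain ⟨b, rfl⟩ : ∃ b : ℕ, N = ((b + 2 : ℕ) : ℤ) := ⟨(N - 2).toNat, by lia⟩
  rw [unitsOpen_eq b, show (((b + 2 : ℕ) : ℤ) - 2).toNat = b by lia]
  exact isoTorusAffine_centersOf (degreesSkip_injective le_rfl) (degreesSkip_lt le_rfl)

theorem isoTorusAffine_unitsHyp {N : ℤ} (hN : 2 ≤ N) :
    IsoTorusAffine (ballsAt N unitsHyp) 1 (N - 2).toNat := by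
  obtain ⟨b, rfl⟩ : ∃ b : ℕ, N = ((b + 2 : ℕ) : ℤ) := ⟨(N - 2).toNat, by lia⟩
  rw [unitsHyp_eq b, show (((b + 2 : ℕ) : ℤ) - 2).toNat = b by lia]
  exact isoTorusAffine_centersOf (degreesSkip_injective one_le_two) (degreesSkip_lt one_le_two)

end

end AffineFlag

theorem mainTheorem1 :
    -- the list of all `I₃`-orbits
    (∀ X : Set Flag, IsOrbit I3 X ↔
      (X = {pt 0 0} ∨ (∃ n : ℤ, n ≠ 0 ∧ X = Eopen n) ∨ (∃ n : ℤ, n < 0 ∧ X = Ehyp n) ∨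
        (∃ n : ℤ, X = Oopen n) ∨ (∃ n : ℤ, n ≤ 0 ∧ X = Ohyp n) ∨
        (∃ n : ℤ, 0 < n ∧ X = EhypOpen n) ∨ (∃ n : ℤ, 0 < n ∧ X = EhypHyp n) ∨
        (∃ n : ℤ, 0 < n ∧ X = OhypOpen n) ∨ (∃ n : ℤ, 0 < n ∧ X = OhypHyp n))) ∧
    -- the point orbits
    (Ohyp 0 = {ptPrime 0 0} ∧ Ohyp (-1) = {ptPrime (-1) 0} ∧ EhypHyp 1 = {pt 1 0} ∧
      ∀ X ∈ ({{pt 0 0}, {ptPrime 0 0}, {ptPrime (-1) 0}, {pt 1 0}} : Set (Set Flag)),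
        IsOrbit I4 X ∧ IsOrbit I4rot X) ∧
    -- the `I₃`-orbits that are already `I₄`-orbits (and also `I₄^rot`-orbits)
    (∀ n : ℤ, n < 0 → (IsOrbit I4 (Eopen n) ∧ IsOrbit I4rot (Eopen n)) ∧
      (IsOrbit I4 (Ehyp n) ∧ IsOrbit I4rot (Ehyp n))) ∧
    (∀ n : ℤ, n ≤ 0 → IsOrbit I4 (Oopen n) ∧ IsOrbit I4rot (Oopen n)) ∧
    (∀ n : ℤ, n ≤ -2 → IsOrbit I4 (Ohyp n) ∧ IsOrbit I4rot (Ohyp n)) ∧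
    (∀ n : ℤ, 0 < n → IsOrbit I4 (EhypOpen n) ∧ IsOrbit I4rot (EhypOpen n)) ∧
    (∀ n : ℤ, 2 ≤ n → IsOrbit I4 (EhypHyp n) ∧ IsOrbit I4rot (EhypHyp n)) ∧
    (∀ n : ℤ, 0 < n → (IsOrbit I4 (OhypOpen n) ∧ IsOrbit I4rot (OhypOpen n)) ∧
      (IsOrbit I4 (OhypHyp n) ∧ IsOrbit I4rot (OhypHyp n))) ∧
    -- the decomposition of `E_n^open`, `n > 0`
    (∀ n : ℤ, 0 < n →
      Eopen n = EopenOpen n ∪ EopenHyp n ∧ Disjoint (EopenOpen n) (EopenHyp n) ∧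
      IsOrbit I4rot (EopenOpen n) ∧ IsoTorusAffine (EopenOpen n) 2 (2 * n - 2).toNat ∧
      IsOrbit I4 (EopenHyp n) ∧ IsOrbit I4rot (EopenHyp n) ∧
      IsoTorusAffine (EopenHyp n) 1 (2 * n - 2).toNat) ∧
    -- the decomposition of `O_n^open`, `n > 0`
    (∀ n : ℤ, 0 < n →
      Oopen n = OopenOpen n ∪ OopenHyp n ∧ Disjoint (OopenOpen n) (OopenHyp n) ∧
      IsOrbit I4rot (OopenOpen n) ∧ IsoTorusAffine (OopenOpen n) 2 (2 * n - 1).toNat ∧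
      IsOrbit I4 (OopenHyp n) ∧ IsOrbit I4rot (OopenHyp n) ∧
      IsoTorusAffine (OopenHyp n) 1 (2 * n - 1).toNat) := by
  refine ⟨isOrbit_I3_iff_isListed, ⟨Ohyp_zero, Ohyp_neg_one, EhypHyp_one,
      fun X hX => (isCommonOrbit_points X hX).2⟩,
    fun n hn => ⟨(isCommonOrbit_Eopen hn).2, (isCommonOrbit_Ehyp hn).2⟩,
    fun n hn => (isCommonOrbit_Oopen hn).2, fun n hn => (isCommonOrbit_Ohyp (by lia)).2,
    fun n hn => (isCommonOrbit_EhypOpen hn).2, fun n hn => (isCommonOrbit_EhypHyp (by lia)).2,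
    fun n hn => ⟨(isCommonOrbit_OhypOpen hn).2, (isCommonOrbit_OhypHyp hn).2⟩,
    fun n hn => ?_, fun n hn => ?_⟩
  · rw [Eopen_of_pos hn, EopenOpen_eq hn, EopenHyp_eq hn]
    exact ⟨ballsAt_hasOrder_zero_eq_union _, disjoint_unitsOpen_unitsHyp (by lia),
      isOrbit_I4rot_unitsOpen (by lia), isoTorusAffine_unitsOpen (by lia),
      isOrbit_I4_unitsHyp (by lia), isOrbit_I4rot_unitsHyp (by lia),
      isoTorusAffine_unitsHyp (by lia)⟩
  · rw [Oopen_of_nonneg hn.le, OopenOpen_eq hn, OopenHyp_eq hn,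
      show 2 * n - 1 = 2 * n + 1 - 2 by ring]
    exact ⟨ballsAt_hasOrder_zero_eq_union _, disjoint_unitsOpen_unitsHyp (by lia),
      isOrbit_I4rot_unitsOpen (by lia), isoTorusAffine_unitsOpen (by lia),
      isOrbit_I4_unitsHyp (by lia), isOrbit_I4rot_unitsHyp (by lia),
      isoTorusAffine_unitsHyp (by lia)⟩
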